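/- Let $\widehat{\mathfrak{sl}}_2=\mathbb C[t,t^{-1}]\otimes\mathfrak{sl}_2\oplus\mathbb Cc\oplus\mathbb Cd$ be the complex affine Lie algebra with bracket $[t^m\otimes x,t^n\otimes y]=t^{m+n}\otimes[x,y]+m\,\delta_{m,-n}\,\mathrm{tr}(xy)\,c$, $[d,t^n\otimes x]=n\,t^n\otimes x$, $c$ central, where $e,f,h$ is the standard basis of $\mathfrak{sl}_2$. Let $\hat\theta$ be its Chevalley involution, $\hat\theta(t^n\otimes x)=-t^{-n}\otimes x^{\mathsf T}$, $\hat\theta(c)=-c$, $\hat\theta(d)=-d$, let $\widehat{\mathfrak{sl}}_2^{\hat\theta}$ be the Lie subalgebra of its fixed points, and let $\mathfrak h=\mathbb Ch_0\oplus\mathbb Ch_1\oplus\mathbb Cd$ with $h_0=-1\otimes h+c$, $h_1=1\otimes h$. Let $Q=\mathbb Z\alpha_0\oplus\mathbb Z\alpha_1$ be the root lattice, $\delta=\alpha_0+\alpha_1$, let $\Phi^+=\{\alpha_1\}\cup\{n\delta+\beta\mid n\ge 1,\ \beta\in\{-\alpha_1,0,\alpha_1\}\}$ be the set of positive roots, $\Phi^-=-\Phi^+$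 and $\Phi=\Phi^+\cup\Phi^-$. For $a=(t_0,t_1,t_d)\in H=(\mathbb C\setminus\{0\})^3$ and $\alpha=n_0\alpha_0+n_1\alpha_1\in Q$ put $\alpha(a)=(t_0t_1^{-1})^{2(n_0-n_1)}t_d^{n_0}$. The torus $H$ acts on $\widehat{\mathfrak{sl}}_2$ by Lie algebra automorphisms $\mathrm{Ad}(a)$ that fix $\mathfrak h$ pointwise and multiply every root vector of root $\alpha\in\Phi$ (that is, $t^n\otimes e$, $t^n\otimes f$, $t^n\otimes h$ of root $n\delta+\alpha_1$, $n\delta-\alpha_1$, $n\delta$ respectively) by $\alpha(a)$; extend this action to $U(\widehat{\mathfrak{sl}}_2)$ and write $X^a=\mathrm{Ad}(a^{-1})(X)$. Let $$H_{\mathrm{reg}}=\{a\in H\mid \alpha(a)\neq\pm1\ \text{for all }\alpha\in\Phi\}.$$ Let $\mathcal R$ be the localization of the group algebra $\mathbb C[Q]=\bigoplus_{\alpha\in Q}\mathbb Ce^\alpha$ at the multiplicative set generated by all $1-e^{2\gamma}$, $\gamma\in\Phi^-$. For $a\in H_{\mathrm{reg}}$ let $f\mapsto f(a)$ denote the algebra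 homomorphism $\mathcal R\to\mathbb C$ with $e^\alpha\mapsto\alpha(a)$, and let $$\Gamma_a:\ \mathcal R\otimes U(\mathfrak h)\otimes U(\widehat{\mathfrak{sl}}_2^{\hat\theta})\otimes U(\widehat{\mathfrak{sl}}_2^{\hat\theta})\to U(\widehat{\mathfrak{sl}}_2)$$ be the linear map with $\Gamma_a(f\otimes Z\otimes X\otimes Y)=f(a)\,X^aZY$ (all tensor products over $\mathbb C$). Theorem. For each $X\in U(\widehat{\mathfrak{sl}}_2)$ there is a unique $\Pi(X)\in\mathcal R\otimes U(\mathfrak h)\otimes U(\widehat{\mathfrak{sl}}_2^{\hat\theta})\otimes U(\widehat{\mathfrak{sl}}_2^{\hat\theta})$ such that $\Gamma_a(\Pi(X))=X$ for every $a\in H_{\mathrm{reg}}$. -/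

import Mathlib

open scoped TensorProduct LaurentPolynomial

noncomputable section

namespace AffineSl2

/-! ### The Lie algebra `sl₂` and its loop algebra -/

/-- The complex Lie algebra `sl₂` of traceless `2 × 2` matrices. -/
abbrev Sl2 : Type := LieAlgebra.SpecialLinear.sl (Fin 2) ℂ

/-- The element `h = diag(1, -1)` of `sl₂`. -/
def hElt : Sl2 := LieAlgebra.SpecialLinear.singleSubSingle 0 1 1

/-- The element `e` of `sl₂`. -/
def eElt : Sl2 := LieAlgebra.SpecialLinear.single 0 1 (by decide) 1

/-- The element `f` of `sl₂`. -/
def fElt : Sl2 := LieAlgebra.SpecialLinear.single 1 0 (by decide) 1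

/-- The invariant form `(x, y) = tr (x y)` on `sl₂`, normalised by `(e, f) = 1`. -/
def form : LinearMap.BilinForm ℂ Sl2 :=
  LinearMap.mk₂ ℂ (fun x y => Matrix.trace (x.val * y.val))
    (by intros; simp [add_mul]) (by intros; simp) (by intros; simp [mul_add]) (by intros; simp)

lemma form_apply (x y : Sl2) : form x y = Matrix.trace (x.val * y.val) := rfl

lemma form_comm (x y : Sl2) : form x y = form y x := by
  rw [form_apply, form_apply, Matrix.trace_mul_comm]

lemma form_lie (x y z : Sl2) : form ⁅x, y⁆ z = form x ⁅y, z⁆ := by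
  simp only [form_apply, LieAlgebra.SpecialLinear.sl_bracket, sub_mul, mul_sub, Matrix.trace_sub]
  rw [Matrix.mul_assoc, Matrix.mul_assoc y.val, Matrix.trace_mul_comm y.val, Matrix.mul_assoc]

/-- The Euler operator `t d/dt` on Laurent polynomials, `tⁿ ↦ n tⁿ`. -/
def euler : ℂ[T;T⁻¹] →ₗ[ℂ] ℂ[T;T⁻¹] :=
  (AddMonoidAlgebra.basis ℤ ℂ).constr ℂ fun n => (n : ℂ) • LaurentPolynomial.T n

/-- The coefficient of `t⁰`. -/
def coeffZero : ℂ[T;T⁻¹] →ₗ[ℂ] ℂ := (AddMonoidAlgebra.basis ℤ ℂ).coord 0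

lemma basis_apply (n : ℤ) :
    AddMonoidAlgebra.basis ℤ ℂ n = (LaurentPolynomial.T n : ℂ[T;T⁻¹]) := by
  rw [LaurentPolynomial.T, AddMonoidAlgebra.basis_apply]

lemma euler_T (n : ℤ) :
    euler (LaurentPolynomial.T n) = (n : ℂ) • LaurentPolynomial.T n := by
  have h := basis_apply n
  rw [euler, ← h, Module.Basis.constr_basis, h]

lemma coeffZero_T (n : ℤ) :
    coeffZero (LaurentPolynomial.T n) = if n = 0 then 1 else 0 := by
  have h := basis_apply n
  rw [coeffZero, ← h, Module.Basis.coord_apply, Module.Basis.repr_self, Finsupp.single_apply]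

lemma linearMap_ext_T {M : Type*} [AddCommGroup M] [Module ℂ M] {f g : ℂ[T;T⁻¹] →ₗ[ℂ] M}
    (h : ∀ n : ℤ, f (LaurentPolynomial.T n) = g (LaurentPolynomial.T n)) : f = g := by
  refine (AddMonoidAlgebra.basis ℤ ℂ).ext fun n => ?_
  rw [basis_apply]; exact h n

lemma euler_mul (f g : ℂ[T;T⁻¹]) : euler (f * g) = euler f * g + f * euler g := by
  have : (LinearMap.mul ℂ ℂ[T;T⁻¹]).compr₂ euler =
      (LinearMap.mul ℂ ℂ[T;T⁻¹]).comp euler + (LinearMap.mul ℂ ℂ[T;T⁻¹]).compl₂ euler := by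
    refine linearMap_ext_T fun m => linearMap_ext_T fun n => ?_
    simp only [LinearMap.compr₂_apply, LinearMap.mul_apply', LinearMap.add_apply,
      LinearMap.comp_apply, LinearMap.compl₂_apply, ← LaurentPolynomial.T_add, euler_T,
      smul_mul_assoc, mul_smul_comm, Int.cast_add, add_smul]
  exact congr($this f g)

lemma coeffZero_euler (f : ℂ[T;T⁻¹]) : coeffZero (euler f) = 0 := by
  have : coeffZero.comp euler = 0 := linearMap_ext_T fun n => by
    rw [LinearMap.comp_apply, euler_T, map_smul, coeffZero_T, LinearMap.zero_apply]
    split_ifs with h <;> simp [h]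
  exact congr($this f)

/-- The loop algebra `ℂ[t, t⁻¹] ⊗ sl₂`, with bracket `[f ⊗ x, g ⊗ y] = f g ⊗ [x, y]`. -/
def Loop : Type := ℂ[T;T⁻¹] ⊗[ℂ] Sl2

instance : LieRing Loop := inferInstanceAs (LieRing (ℂ[T;T⁻¹] ⊗[ℂ] Sl2))
instance : LieAlgebra ℂ Loop := inferInstanceAs (LieAlgebra ℂ (ℂ[T;T⁻¹] ⊗[ℂ] Sl2))

/-- The pure tensor `f ⊗ x` in the loop algebra. -/
def tens (f : ℂ[T;T⁻¹]) (x : Sl2) : Loop := f ⊗ₜ[ℂ] x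

lemma tens_add_left (f g : ℂ[T;T⁻¹]) (x : Sl2) : tens (f + g) x = tens f x + tens g x :=
  TensorProduct.add_tmul f g x

lemma tens_smul_left (r : ℂ) (f : ℂ[T;T⁻¹]) (x : Sl2) : tens (r • f) x = r • tens f x :=
  (TensorProduct.smul_tmul' r f x).symm

lemma tens_lie (f g : ℂ[T;T⁻¹]) (x y : Sl2) : ⁅tens f x, tens g y⁆ = tens (f * g) ⁅x, y⁆ := rfl

@[elab_as_elim]
lemma loop_induction {p : Loop → Prop} (z : Loop) (zero : p 0) (tmul : ∀ f x, p (tens f x))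
    (add : ∀ x y, p x → p y → p (x + y)) : p z :=
  TensorProduct.induction_on z zero tmul add

/-- The degree derivation `tⁿ ⊗ x ↦ n tⁿ ⊗ x` of the loop algebra. -/
def degree : Loop →ₗ[ℂ] Loop :=
  (TensorProduct.map euler LinearMap.id : ℂ[T;T⁻¹] ⊗[ℂ] Sl2 →ₗ[ℂ] ℂ[T;T⁻¹] ⊗[ℂ] Sl2)

lemma degree_tens (f : ℂ[T;T⁻¹]) (x : Sl2) : degree (tens f x) = tens (euler f) x := rfl

lemma degree_lie (x y : Loop) : degree ⁅x, y⁆ = ⁅degree x, y⁆ + ⁅x, degree y⁆ := by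
  induction x using loop_induction with
  | zero => simp
  | add a b ha hb => simp only [add_lie, map_add, ha, hb]; abel
  | tmul f u =>
    induction y using loop_induction with
    | zero => simp
    | add a b ha hb => simp only [lie_add, map_add, ha, hb]; abel
    | tmul g v => simp [tens_lie, degree_tens, euler_mul, tens_add_left]

/-- The form `(f, g) ↦ Res (g df)` on Laurent polynomials, `(tᵐ, tⁿ) ↦ m δ_{m,-n}`. -/
def residueForm : LinearMap.BilinForm ℂ ℂ[T;T⁻¹] :=
  ((LinearMap.mul ℂ ℂ[T;T⁻¹]).comp euler).compr₂ coeffZero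

lemma residueForm_apply (f g : ℂ[T;T⁻¹]) : residueForm f g = coeffZero (euler f * g) := rfl

/-- The form `(tᵐ ⊗ x, tⁿ ⊗ y) ↦ m δ_{m,-n} (x, y)` on the loop algebra. -/
def cocycle : LinearMap.BilinForm ℂ Loop :=
  (residueForm.tmul form : LinearMap.BilinForm ℂ (ℂ[T;T⁻¹] ⊗[ℂ] Sl2))

lemma cocycle_tens (f g : ℂ[T;T⁻¹]) (x y : Sl2) :
    cocycle (tens f x) (tens g y) = form x y * residueForm f g :=
  LinearMap.BilinForm.tensorDistrib_tmul ..

lemma cocycle_T (m n : ℤ) (x y : Sl2) :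
    cocycle (tens (LaurentPolynomial.T m) x) (tens (LaurentPolynomial.T n) y) =
      if m = -n then (m : ℂ) * form x y else 0 := by
  simp only [cocycle_tens, residueForm_apply, euler_T, smul_mul_assoc, ← LaurentPolynomial.T_add,
    map_smul, coeffZero_T, eq_neg_iff_add_eq_zero]
  split_ifs <;> simp [mul_comm]

lemma cocycle_skew (x y : Loop) : cocycle y x = -cocycle x y := by
  induction x using loop_induction with
  | zero => simp
  | add a b ha hb => simp only [map_add, LinearMap.add_apply, ha, hb]; abel
  | tmul f u =>
    induction y using loop_induction with
    | zero => simp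
    | add a b ha hb => simp only [map_add, LinearMap.add_apply, ha, hb]; abel
    | tmul g v =>
      have h := coeffZero_euler (f * g)
      rw [euler_mul, map_add, mul_comm f] at h
      simp only [cocycle_tens, residueForm_apply, form_comm v u]
      linear_combination form u v * h

lemma cocycle_degree (x y : Loop) : cocycle (degree x) y + cocycle x (degree y) = 0 := by
  induction x using loop_induction with
  | zero => simp
  | add a b ha hb =>
    simp only [map_add, LinearMap.add_apply]
    linear_combination ha + hb
  | tmul f u =>
    induction y using loop_induction with
    | zero => simp
    | add a b ha hb =>
      simp only [map_add]
      linear_combination ha + hb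
    | tmul g v =>
      have h := coeffZero_euler (euler f * g)
      rw [euler_mul, map_add] at h
      simp only [degree_tens, cocycle_tens, residueForm_apply]
      linear_combination form u v * h

lemma cocycle_lie (x y z : Loop) :
    cocycle x ⁅y, z⁆ = cocycle ⁅x, y⁆ z + cocycle y ⁅x, z⁆ := by
  induction x using loop_induction with
  | zero => simp
  | add a b ha hb => simp only [map_add, LinearMap.add_apply, add_lie, ha, hb]; abel
  | tmul f u =>
    induction y using loop_induction with
    | zero => simp
    | add a b ha hb => simp only [map_add, LinearMap.add_apply, add_lie, lie_add, ha, hb]; abel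
    | tmul g v =>
      induction z using loop_induction with
      | zero => simp
      | add a b ha hb => simp only [map_add, lie_add, ha, hb]; abel
      | tmul k w =>
        have h := coeffZero_euler (f * g * k)
        simp only [euler_mul, add_mul, map_add] at h
        have h1 : form v ⁅u, w⁆ = -form u ⁅v, w⁆ := by
          rw [← form_lie, ← form_lie, ← lie_skew, map_neg, LinearMap.neg_apply]
        simp only [tens_lie, cocycle_tens, residueForm_apply,
          form_lie u v w, h1, euler_mul, add_mul, map_add]
        have e1 : euler f * (g * k) = euler f * g * k := by ring
        have e2 : euler g * (f * k) = f * euler g * k := by ring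
        rw [e1, e2]
        ring

/-! ### The affine Lie algebra -/

/-- The affine Lie algebra `ℂ[t, t⁻¹] ⊗ sl₂ ⊕ ℂ c ⊕ ℂ d`; the element `⟨x, r, s⟩` stands for
`x + r c + s d`. -/
@[ext] structure Hat where
  /-- component in the loop algebra -/
  loop : Loop
  /-- coefficient of `c` -/
  cen : ℂ
  /-- coefficient of `d` -/
  der : ℂ

namespace Hat

/-- The underlying triple. -/
def toProd : Hat ≃ Loop × ℂ × ℂ where
  toFun x := (x.loop, x.cen, x.der)
  invFun x := ⟨x.1, x.2.1, x.2.2⟩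
  left_inv _ := rfl
  right_inv _ := rfl

instance : AddCommGroup Hat := toProd.addCommGroup
instance : Module ℂ Hat := toProd.module ℂ

@[simp] lemma loop_zero : (0 : Hat).loop = 0 := rfl
@[simp] lemma cen_zero : (0 : Hat).cen = 0 := rfl
@[simp] lemma der_zero : (0 : Hat).der = 0 := rfl
@[simp] lemma loop_add (x y : Hat) : (x + y).loop = x.loop + y.loop := rfl
@[simp] lemma cen_add (x y : Hat) : (x + y).cen = x.cen + y.cen := rfl
@[simp] lemma der_add (x y : Hat) : (x + y).der = x.der + y.der := rfl
@[simp] lemma loop_smul (r : ℂ) (x : Hat) : (r • x).loop = r • x.loop := rfl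
@[simp] lemma cen_smul (r : ℂ) (x : Hat) : (r • x).cen = r * x.cen := rfl
@[simp] lemma der_smul (r : ℂ) (x : Hat) : (r • x).der = r * x.der := rfl

/-- The bracket determined by
`[tᵐ ⊗ x, tⁿ ⊗ y] = tᵐ⁺ⁿ ⊗ [x, y] + m δ_{m,-n} (x, y) c`, `[d, tⁿ ⊗ x] = n tⁿ ⊗ x`, `c` central. -/
instance : Bracket Hat Hat where
  bracket x y :=
    ⟨⁅x.loop, y.loop⁆ + x.der • degree y.loop - y.der • degree x.loop,
      cocycle x.loop y.loop, 0⟩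

@[simp] lemma loop_lie (x y : Hat) :
    ⁅x, y⁆.loop = ⁅x.loop, y.loop⁆ + x.der • degree y.loop - y.der • degree x.loop := rfl
@[simp] lemma cen_lie (x y : Hat) : ⁅x, y⁆.cen = cocycle x.loop y.loop := rfl
@[simp] lemma der_lie (x y : Hat) : ⁅x, y⁆.der = 0 := rfl

instance : LieRing Hat where
  add_lie x y z := by
    ext
    · simp only [loop_lie, loop_add, der_add, add_lie, add_smul, map_add, smul_add]; abel
    · simp
    · simp
  lie_add x y z := by
    ext
    · simp only [loop_lie, loop_add, der_add, lie_add, add_smul, map_add, smul_add]; abel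
    · simp
    · simp
  lie_self x := by
    ext
    · simp
    · have h := cocycle_skew x.loop x.loop
      simp only [cen_lie, cen_zero]
      linear_combination h / 2
    · simp
  leibniz_lie x y z := by
    ext
    · simp only [loop_lie, loop_add, der_lie, lie_add, lie_sub, add_lie, sub_lie, lie_smul,
        smul_lie, map_add, map_sub, map_smul, degree_lie, zero_smul, smul_add, smul_sub,
        leibniz_lie x.loop y.loop z.loop]
      rw [smul_comm x.der y.der, smul_comm x.der z.der, smul_comm y.der z.der,
        ← lie_skew (degree x.loop) y.loop]
      simp only [smul_neg]
      abel
    · have h1 := cocycle_degree x.loop y.loop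
      have h2 := cocycle_degree x.loop z.loop
      have h3 := cocycle_degree y.loop z.loop
      have h4 := cocycle_skew (degree x.loop) y.loop
      simp only [cen_lie, loop_lie, cen_add, map_add, map_sub, map_smul, LinearMap.add_apply,
        LinearMap.sub_apply, LinearMap.smul_apply, smul_eq_mul,
        cocycle_lie x.loop y.loop z.loop]
      linear_combination -x.der * h3 + y.der * h2 - z.der * h1 + z.der * h4
    · simp

instance : LieAlgebra ℂ Hat where
  lie_smul r x y := by
    ext
    · simp only [loop_lie, loop_smul, der_smul, lie_smul, map_smul, smul_sub, smul_add, mul_smul,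
        smul_comm x.der r]
    · simp
    · simp

end Hat

/-! ### The Chevalley involution and its fixed subalgebra -/

/-- The Chevalley involution `x ↦ -xᵀ` of `sl₂`: `e ↦ -f`, `f ↦ -e`, `h ↦ -h`. -/
def theta : Sl2 →ₗ⁅ℂ⁆ Sl2 where
  toFun x := ⟨-x.val.transpose, by
    have h : Matrix.trace x.val = 0 := x.property
    change Matrix.trace (-x.val.transpose) = 0
    rw [Matrix.trace_neg, Matrix.trace_transpose, h, neg_zero]⟩
  map_add' x y := Subtype.ext (by
    change -(x.val + y.val).transpose = -x.val.transpose + -y.val.transpose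
    rw [Matrix.transpose_add, neg_add])
  map_smul' r x := Subtype.ext (by
    change -(r • x.val).transpose = r • -x.val.transpose
    rw [Matrix.transpose_smul, smul_neg])
  map_lie' {x y} := Subtype.ext (by
    change -(x.val * y.val - y.val * x.val).transpose =
      -x.val.transpose * -y.val.transpose - -y.val.transpose * -x.val.transpose
    rw [Matrix.transpose_sub, Matrix.transpose_mul, Matrix.transpose_mul, neg_mul_neg,
      neg_mul_neg, neg_sub])

lemma theta_val (x : Sl2) : (theta x).val = -x.val.transpose := rfl

lemma form_theta (x y : Sl2) : form (theta x) (theta y) = form x y := by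
  rw [form_apply, form_apply, theta_val, theta_val, neg_mul_neg, ← Matrix.transpose_mul,
    Matrix.trace_transpose, Matrix.trace_mul_comm]

/-- The endomorphism `f ⊗ x ↦ φ f ⊗ g x` of the loop algebra. -/
def loopMap (φ : ℂ[T;T⁻¹] →ₐ[ℂ] ℂ[T;T⁻¹]) (g : Sl2 →ₗ⁅ℂ⁆ Sl2) : Loop →ₗ⁅ℂ⁆ Loop :=
  (LieAlgebra.ExtendScalars.map φ g : ℂ[T;T⁻¹] ⊗[ℂ] Sl2 →ₗ⁅ℂ⁆ ℂ[T;T⁻¹] ⊗[ℂ] Sl2)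

lemma loopMap_tens (φ : ℂ[T;T⁻¹] →ₐ[ℂ] ℂ[T;T⁻¹]) (g : Sl2 →ₗ⁅ℂ⁆ Sl2) (f : ℂ[T;T⁻¹]) (x : Sl2) :
    loopMap φ g (tens f x) = tens (φ f) (g x) := rfl

/-- If `φ` commutes up to the sign `s` with `t d/dt`, then so does `loopMap φ g` with `degree`. -/
lemma degree_loopMap {φ : ℂ[T;T⁻¹] →ₐ[ℂ] ℂ[T;T⁻¹]} (g : Sl2 →ₗ⁅ℂ⁆ Sl2) {s : ℂ}
    (hφ : ∀ f, euler (φ f) = s • φ (euler f)) (x : Loop) :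
    degree (loopMap φ g x) = s • loopMap φ g (degree x) := by
  induction x using loop_induction with
  | zero => simp
  | add a b ha hb => simp only [map_add, ha, hb, smul_add]
  | tmul f u => simp only [loopMap_tens, degree_tens, hφ, tens_smul_left]

lemma cocycle_loopMap {φ : ℂ[T;T⁻¹] →ₐ[ℂ] ℂ[T;T⁻¹]} {g : Sl2 →ₗ⁅ℂ⁆ Sl2} {s : ℂ}
    (hφ : ∀ f, euler (φ f) = s • φ (euler f)) (hφ' : ∀ f, coeffZero (φ f) = coeffZero f)
    (hg : ∀ x y, form (g x) (g y) = form x y) (x y : Loop) :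
    cocycle (loopMap φ g x) (loopMap φ g y) = s * cocycle x y := by
  induction x using loop_induction with
  | zero => simp
  | add a b ha hb => simp only [map_add, LinearMap.add_apply, ha, hb, mul_add]
  | tmul f u =>
    induction y using loop_induction with
    | zero => simp
    | add a b ha hb => simp only [map_add, ha, hb, mul_add]
    | tmul k v =>
      simp only [loopMap_tens, cocycle_tens, residueForm_apply, hφ, hg, smul_mul_assoc, map_smul,
        ← map_mul, hφ', smul_eq_mul]
      ring

/-- The algebra automorphism `t ↦ t⁻¹` of the Laurent polynomials. -/
def invertT : ℂ[T;T⁻¹] →ₐ[ℂ] ℂ[T;T⁻¹] := LaurentPolynomial.invert.toAlgHom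

lemma invertT_T (n : ℤ) : invertT (LaurentPolynomial.T n) = LaurentPolynomial.T (-n) :=
  LaurentPolynomial.invert_T n

lemma euler_invertT (f : ℂ[T;T⁻¹]) : euler (invertT f) = (-1 : ℂ) • invertT (euler f) := by
  have : euler ∘ₗ invertT.toLinearMap = (-1 : ℂ) • (invertT.toLinearMap ∘ₗ euler) :=
    linearMap_ext_T fun n => by
      simp only [LinearMap.comp_apply, AlgHom.toLinearMap_apply, LinearMap.smul_apply, invertT_T,
        euler_T, map_smul, smul_smul]
      simp
  exact congr($this f)

lemma coeffZero_invertT (f : ℂ[T;T⁻¹]) : coeffZero (invertT f) = coeffZero f := by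
  have : coeffZero ∘ₗ invertT.toLinearMap = coeffZero := linearMap_ext_T fun n => by
    simp only [LinearMap.comp_apply, AlgHom.toLinearMap_apply, invertT_T, coeffZero_T, neg_eq_zero]
  exact congr($this f)

/-- The Chevalley involution of the affine Lie algebra: `tⁿ ⊗ x ↦ t⁻ⁿ ⊗ θ(x)`, `c ↦ -c`,
`d ↦ -d`. -/
def thetaHat : Hat →ₗ⁅ℂ⁆ Hat where
  toFun x := ⟨loopMap invertT theta x.loop, -x.cen, -x.der⟩
  map_add' x y := by ext <;> simp [add_comm]
  map_smul' r x := by ext <;> simp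
  map_lie' {x y} := by
    ext
    · simp only [Hat.loop_lie, map_add, map_sub, map_smul, LieHom.map_lie,
        degree_loopMap theta euler_invertT, smul_smul]
      simp
    · simp only [Hat.cen_lie, cocycle_loopMap euler_invertT coeffZero_invertT form_theta]
      simp
    · simp

/-- The fixed Lie subalgebra of the Chevalley involution (the Onsager algebra). -/
def fixedSubalgebra : LieSubalgebra ℂ Hat where
  carrier := {x | thetaHat x = x}
  add_mem' {x y} hx hy := by
    change thetaHat (x + y) = x + y
    rw [map_add, show thetaHat x = x from hx, show thetaHat y = y from hy]
  zero_mem' := map_zero thetaHat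
  smul_mem' r x hx := by
    change thetaHat (r • x) = r • x
    rw [map_smul, show thetaHat x = x from hx]
  lie_mem' {x y} hx hy := by
    change thetaHat ⁅x, y⁆ = ⁅x, y⁆
    rw [LieHom.map_lie, show thetaHat x = x from hx, show thetaHat y = y from hy]

/-! ### The Cartan subalgebra -/

namespace Hat

/-- `h₀ = -1 ⊗ h + c`. -/
def h0 : Hat := ⟨-tens 1 hElt, 1, 0⟩

/-- `h₁ = 1 ⊗ h`. -/
def h1 : Hat := ⟨tens 1 hElt, 0, 0⟩

/-- The degree element `d`. -/
def d : Hat := ⟨0, 0, 1⟩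

end Hat

lemma degree_tens_one (x : Sl2) : degree (tens 1 x) = 0 := by
  rw [degree_tens, ← LaurentPolynomial.T_zero, euler_T, tens_smul_left, Int.cast_zero, zero_smul]

lemma cocycle_tens_one (x y : Sl2) : cocycle (tens 1 x) (tens 1 y) = 0 := by
  rw [← LaurentPolynomial.T_zero, cocycle_T]
  simp

lemma lie_eq_zero_of_mem_span {x y : Hat}
    (hx : x ∈ Submodule.span ℂ {Hat.h0, Hat.h1, Hat.d})
    (hy : y ∈ Submodule.span ℂ {Hat.h0, Hat.h1, Hat.d}) : ⁅x, y⁆ = 0 := by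
  induction hx, hy using Submodule.span_induction₂ with
  | mem_mem x y hx hy =>
    rcases hx with rfl | rfl | rfl <;> rcases hy with rfl | rfl | rfl <;> ext <;>
      simp [Hat.h0, Hat.h1, Hat.d, degree_tens_one, cocycle_tens_one]
  | zero_left y hy => simp
  | zero_right x hx => simp
  | add_left x y z hx hy hz h1 h2 => simp [h1, h2]
  | add_right x y z hx hy hz h1 h2 => simp [h1, h2]
  | smul_left r x y hx hy h => simp [h]
  | smul_right r x y hx hy h => simp [h]

/-- The Cartan subalgebra, the linear span of `h₀`, `h₁`, `d`. -/
def cartan : LieSubalgebra ℂ Hat :=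
  { Submodule.span ℂ {Hat.h0, Hat.h1, Hat.d} with
    lie_mem' := fun {x y} hx hy => by
      have h := lie_eq_zero_of_mem_span hx hy
      change ⁅x, y⁆ ∈ Submodule.span ℂ {Hat.h0, Hat.h1, Hat.d}
      rw [h]
      exact Submodule.zero_mem _ }

/-! ### Roots and the torus -/

/-- The root lattice `ℤ α₀ ⊕ ℤ α₁`; the pair `(n₀, n₁)` stands for `n₀ α₀ + n₁ α₁`. -/
abbrev RootLattice : Type := ℤ × ℤ

/-- The simple root `α₁`. -/
def alpha1 : RootLattice := (0, 1)

/-- The null root `δ = α₀ + α₁`. -/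
def delta : RootLattice := (1, 1)

/-- The positive roots: `α₁` and `n δ + β` with `n ≥ 1` and `β ∈ {-α₁, 0, α₁}`. -/
def posRoots : Set RootLattice :=
  {alpha1} ∪ {α | ∃ n : ℕ, 1 ≤ n ∧ ∃ β ∈ ({-alpha1, 0, alpha1} : Set RootLattice),
    α = n • delta + β}

/-- The negative roots. -/
def negRoots : Set RootLattice := {α | -α ∈ posRoots}

/-- The root system. -/
def roots : Set RootLattice := posRoots ∪ negRoots

/-- The torus `(ℂ \ {0})³` of triples `(t₀, t₁, t_d)`. -/
abbrev Torus : Type := ℂˣ × ℂˣ × ℂˣ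

/-- The value `α(a) = (t₀ t₁⁻¹)^(2 (n₀ - n₁)) t_d ^ n₀` of `α = n₀ α₀ + n₁ α₁` at
`a = (t₀, t₁, t_d)`. -/
def rootValue (a : Torus) (α : RootLattice) : ℂˣ :=
  (a.1 * a.2.1⁻¹) ^ (2 * (α.1 - α.2)) * a.2.2 ^ α.1

lemma rootValue_zero (a : Torus) : rootValue a 0 = 1 := by simp [rootValue]

lemma rootValue_add (a : Torus) (α β : RootLattice) :
    rootValue a (α + β) = rootValue a α * rootValue a β := by
  have h : 2 * ((α + β).1 - (α + β).2) = 2 * (α.1 - α.2) + 2 * (β.1 - β.2) := by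
    simp only [Prod.fst_add, Prod.snd_add]; ring
  rw [rootValue, h, Prod.fst_add, zpow_add, zpow_add, rootValue, rootValue]
  exact mul_mul_mul_comm ..

/-- The regular elements of the torus: no root takes the value `1` or `-1`. -/
def regular : Set Torus := {a | ∀ α ∈ roots, rootValue a α ^ 2 ≠ 1}

/-! ### The adjoint action of the torus -/

/-- The matrix map `(a, b; c, d) ↦ (a, q b; q⁻¹ c, d)`. -/
def scaleMat (q : ℂˣ) (M : Matrix (Fin 2) (Fin 2) ℂ) : Matrix (Fin 2) (Fin 2) ℂ :=
  !![M 0 0, (q : ℂ) * M 0 1; ((q⁻¹ : ℂˣ) : ℂ) * M 1 0, M 1 1]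

lemma scaleMat_add (q : ℂˣ) (M N : Matrix (Fin 2) (Fin 2) ℂ) :
    scaleMat q (M + N) = scaleMat q M + scaleMat q N := by
  ext i j; fin_cases i <;> fin_cases j <;> simp [scaleMat, mul_add]

lemma scaleMat_smul (q : ℂˣ) (r : ℂ) (M : Matrix (Fin 2) (Fin 2) ℂ) :
    scaleMat q (r • M) = r • scaleMat q M := by
  ext i j; fin_cases i <;> fin_cases j <;> simp [scaleMat, mul_left_comm]

lemma scaleMat_sub (q : ℂˣ) (M N : Matrix (Fin 2) (Fin 2) ℂ) :
    scaleMat q (M - N) = scaleMat q M - scaleMat q N := by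
  ext i j; fin_cases i <;> fin_cases j <;> simp [scaleMat, mul_sub]

lemma scaleMat_mul (q : ℂˣ) (M N : Matrix (Fin 2) (Fin 2) ℂ) :
    scaleMat q (M * N) = scaleMat q M * scaleMat q N := by
  have hq : (q : ℂ) ≠ 0 := q.ne_zero
  ext i j
  fin_cases i <;> fin_cases j <;>
    simp [scaleMat, Matrix.mul_apply, Fin.sum_univ_two] <;> field_simp

lemma trace_scaleMat (q : ℂˣ) (M : Matrix (Fin 2) (Fin 2) ℂ) :
    Matrix.trace (scaleMat q M) = Matrix.trace M := by
  simp [scaleMat, Matrix.trace_fin_two]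

/-- The automorphism of `sl₂` scaling `e` by `q`, `f` by `q⁻¹` and fixing `h`. -/
def scaleSl2 (q : ℂˣ) : Sl2 →ₗ⁅ℂ⁆ Sl2 where
  toFun x := ⟨scaleMat q x.val, (trace_scaleMat q x.val).trans x.property⟩
  map_add' x y := Subtype.ext (scaleMat_add q x.val y.val)
  map_smul' r x := Subtype.ext (scaleMat_smul q r x.val)
  map_lie' {x y} := Subtype.ext (by
    change scaleMat q (x.val * y.val - y.val * x.val) =
      scaleMat q x.val * scaleMat q y.val - scaleMat q y.val * scaleMat q x.val
    rw [scaleMat_sub, scaleMat_mul, scaleMat_mul])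

lemma scaleSl2_val (q : ℂˣ) (x : Sl2) : (scaleSl2 q x).val = scaleMat q x.val := rfl

lemma form_scaleSl2 (q : ℂˣ) (x y : Sl2) : form (scaleSl2 q x) (scaleSl2 q y) = form x y := by
  rw [form_apply, form_apply, scaleSl2_val, scaleSl2_val, ← scaleMat_mul, trace_scaleMat]

/-- The algebra automorphism `tⁿ ↦ uⁿ tⁿ` of the Laurent polynomials. -/
def scaleT (u : ℂˣ) : ℂ[T;T⁻¹] →ₐ[ℂ] ℂ[T;T⁻¹] :=
  AddMonoidAlgebra.lift ℂ ℂ[T;T⁻¹] ℤ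
    { toFun := fun n => ((u ^ n.toAdd : ℂˣ) : ℂ) • LaurentPolynomial.T n.toAdd
      map_one' := by simp
      map_mul' := fun m n => by
        rw [toAdd_mul, zpow_add, LaurentPolynomial.T_add, smul_mul_smul_comm, Units.val_mul] }

lemma scaleT_T (u : ℂˣ) (n : ℤ) :
    scaleT u (LaurentPolynomial.T n) = ((u ^ n : ℂˣ) : ℂ) • LaurentPolynomial.T n := by
  rw [scaleT, LaurentPolynomial.T, AddMonoidAlgebra.lift_single, one_smul]
  rfl

lemma euler_scaleT (u : ℂˣ) (f : ℂ[T;T⁻¹]) :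
    euler (scaleT u f) = (1 : ℂ) • scaleT u (euler f) := by
  have : euler ∘ₗ (scaleT u).toLinearMap = (1 : ℂ) • ((scaleT u).toLinearMap ∘ₗ euler) :=
    linearMap_ext_T fun n => by
      simp only [LinearMap.comp_apply, AlgHom.toLinearMap_apply, one_smul, scaleT_T, euler_T,
        map_smul]
      exact smul_comm ..
  exact congr($this f)

lemma coeffZero_scaleT (u : ℂˣ) (f : ℂ[T;T⁻¹]) : coeffZero (scaleT u f) = coeffZero f := by
  have : coeffZero ∘ₗ (scaleT u).toLinearMap = coeffZero := linearMap_ext_T fun n => by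
    simp only [LinearMap.comp_apply, AlgHom.toLinearMap_apply, scaleT_T, map_smul, coeffZero_T]
    split_ifs with h <;> simp [h]
  exact congr($this f)

/-- The adjoint action of the torus by Lie algebra automorphisms: `Ad(a)` fixes the Cartan
subalgebra and multiplies every root vector of root `α` by `α(a)`; so
`tⁿ ⊗ x ↦ δ(a)ⁿ tⁿ ⊗ (x₀₀, α₁(a) x₀₁; α₁(a)⁻¹ x₁₀, x₁₁)`. -/
def Ad (a : Torus) : Hat →ₗ⁅ℂ⁆ Hat where
  toFun x :=
    ⟨loopMap (scaleT (rootValue a delta)) (scaleSl2 (rootValue a alpha1)) x.loop, x.cen, x.der⟩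
  map_add' x y := by ext <;> simp
  map_smul' r x := by ext <;> simp
  map_lie' {x y} := by
    ext
    · simp only [Hat.loop_lie, map_add, map_sub, map_smul, LieHom.map_lie,
        degree_loopMap _ (euler_scaleT _), one_smul]
    · simp only [Hat.cen_lie,
        cocycle_loopMap (euler_scaleT _) (coeffZero_scaleT _) (form_scaleSl2 _), one_mul]
    · simp

lemma rootValue_zsmul_delta (a : Torus) (n : ℤ) :
    rootValue a (n • delta) = rootValue a delta ^ n := by
  simp [rootValue, delta]

lemma tens_smul_right (r : ℂ) (f : ℂ[T;T⁻¹]) (x : Sl2) : tens f (r • x) = r • tens f x :=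
  TensorProduct.tmul_smul r f x

lemma Ad_tens_T (a : Torus) (n : ℤ) (x : Sl2) (r : ℂˣ)
    (hx : scaleSl2 (rootValue a alpha1) x = (r : ℂ) • x) :
    Ad a ⟨tens (LaurentPolynomial.T n) x, 0, 0⟩ =
      ((rootValue a (n • delta) * r : ℂˣ) : ℂ) • ⟨tens (LaurentPolynomial.T n) x, 0, 0⟩ := by
  ext
  · change loopMap _ _ (tens _ x) = _ • tens _ x
    rw [loopMap_tens, scaleT_T, hx, tens_smul_left, tens_smul_right, smul_smul,
      rootValue_zsmul_delta, Units.val_mul]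
  · exact (mul_zero _).symm
  · exact (mul_zero _).symm

/-- `Ad(a)` acts on the root vector `tⁿ ⊗ e` of root `n δ + α₁` by the value of that root. -/
lemma Ad_e (a : Torus) (n : ℤ) :
    Ad a ⟨tens (LaurentPolynomial.T n) eElt, 0, 0⟩ =
      (rootValue a (n • delta + alpha1) : ℂ) • ⟨tens (LaurentPolynomial.T n) eElt, 0, 0⟩ := by
  rw [rootValue_add]
  refine Ad_tens_T a n eElt _ (Subtype.ext ?_)
  change scaleMat _ (Matrix.single 0 1 1) = _ • Matrix.single 0 1 1
  ext i j; fin_cases i <;> fin_cases j <;> simp [scaleMat]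

/-- `Ad(a)` acts on the root vector `tⁿ ⊗ f` of root `n δ - α₁` by the value of that root. -/
lemma Ad_f (a : Torus) (n : ℤ) :
    Ad a ⟨tens (LaurentPolynomial.T n) fElt, 0, 0⟩ =
      (rootValue a (n • delta + -alpha1) : ℂ) • ⟨tens (LaurentPolynomial.T n) fElt, 0, 0⟩ := by
  have h : rootValue a (-alpha1) = (rootValue a alpha1)⁻¹ := by
    rw [eq_inv_iff_mul_eq_one, ← rootValue_add, neg_add_cancel, rootValue_zero]
  rw [rootValue_add, h]
  refine Ad_tens_T a n fElt _ (Subtype.ext ?_)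
  change scaleMat _ (Matrix.single 1 0 1) = _ • Matrix.single 1 0 1
  ext i j; fin_cases i <;> fin_cases j <;> simp [scaleMat]

/-- `Ad(a)` acts on the vector `tⁿ ⊗ h` of weight `n δ` by the value of that weight. -/
lemma Ad_h (a : Torus) (n : ℤ) :
    Ad a ⟨tens (LaurentPolynomial.T n) hElt, 0, 0⟩ =
      (rootValue a (n • delta) : ℂ) • ⟨tens (LaurentPolynomial.T n) hElt, 0, 0⟩ := by
  have h := Ad_tens_T a n hElt 1 (Subtype.ext (by
    change scaleMat _ (Matrix.single 0 0 1 - Matrix.single 1 1 1) =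
      (1 : ℂ) • (Matrix.single 0 0 1 - Matrix.single 1 1 1)
    ext i j; fin_cases i <;> fin_cases j <;> simp [scaleMat]))
  rwa [mul_one] at h

/-! ### Enveloping algebras and the conjugation `X ↦ Xᵃ` -/

/-- The enveloping algebra `U(𝔤)` of the affine Lie algebra. -/
abbrev UHat : Type := UniversalEnvelopingAlgebra ℂ Hat

section

attribute [local instance] LieRing.ofAssociativeRing

/-- The algebra homomorphism `U(𝔨) → U(𝔤)` induced by a Lie algebra homomorphism `𝔨 → 𝔤`. -/
def envMap {K : Type*} [LieRing K] [LieAlgebra ℂ K] (f : K →ₗ⁅ℂ⁆ Hat) :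
    UniversalEnvelopingAlgebra ℂ K →ₐ[ℂ] UHat :=
  UniversalEnvelopingAlgebra.lift ℂ ((UniversalEnvelopingAlgebra.ι ℂ).comp f)

lemma envMap_ι {K : Type*} [LieRing K] [LieAlgebra ℂ K] (f : K →ₗ⁅ℂ⁆ Hat) (x : K) :
    envMap f (UniversalEnvelopingAlgebra.ι ℂ x) = UniversalEnvelopingAlgebra.ι ℂ (f x) :=
  UniversalEnvelopingAlgebra.lift_ι_apply ..

end

/-- `Xᵃ = Ad(a⁻¹)(X)` for `X ∈ U(𝔤)`. -/
def conjBy (a : Torus) : UHat →ₐ[ℂ] UHat := envMap (Ad a⁻¹)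

/-- The enveloping algebra `U(𝔥)` of the Cartan subalgebra. -/
abbrev UCartan : Type := UniversalEnvelopingAlgebra ℂ cartan

/-- The enveloping algebra of the fixed subalgebra of the Chevalley involution. -/
abbrev UFixed : Type := UniversalEnvelopingAlgebra ℂ fixedSubalgebra

/-- The linear map `U(𝔥) ⊗ U(𝔨) ⊗ U(𝔨) → U(𝔤)`, `H ⊗ X ⊗ Y ↦ Xᵃ H Y`, where `𝔨` is the fixed
subalgebra of the Chevalley involution. -/
def gammaBase (a : Torus) : UCartan ⊗[ℂ] UFixed ⊗[ℂ] UFixed →ₗ[ℂ] UHat :=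
  TensorProduct.lift
    ((LinearMap.mul ℂ UHat).compl₁₂
      (TensorProduct.lift
        ((LinearMap.mul ℂ UHat).flip.compl₁₂ (envMap cartan.incl).toLinearMap
          ((conjBy a).toLinearMap ∘ₗ (envMap fixedSubalgebra.incl).toLinearMap)))
      (envMap fixedSubalgebra.incl).toLinearMap)

lemma gammaBase_tmul (a : Torus) (H : UCartan) (X Y : UFixed) :
    gammaBase a (H ⊗ₜ X ⊗ₜ Y) =
      conjBy a (envMap fixedSubalgebra.incl X) * envMap cartan.incl H *
        envMap fixedSubalgebra.incl Y := rfl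

/-! ### The coefficient ring -/

/-- The basis element `e^α` of the group algebra `ℂ[Q]`. -/
def expQ (α : RootLattice) : AddMonoidAlgebra ℂ RootLattice := AddMonoidAlgebra.single α 1

/-- The multiplicative set generated by all `1 - e^{2γ}` for negative roots `γ`. -/
def denominators : Submonoid (AddMonoidAlgebra ℂ RootLattice) :=
  Submonoid.closure {p | ∃ γ ∈ negRoots, p = 1 - expQ (2 • γ)}

/-- The localization `R` of the group algebra `ℂ[Q]` at all `1 - e^{2γ}`, `γ` a negative root. -/
abbrev CoeffRing : Type := Localization denominators

/-- Evaluation `ℂ[Q] → ℂ` at a point of the torus, `e^α ↦ α(a)`. -/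
def evalQ (a : Torus) : AddMonoidAlgebra ℂ RootLattice →ₐ[ℂ] ℂ :=
  AddMonoidAlgebra.lift ℂ ℂ RootLattice
    { toFun := fun α => (rootValue a α.toAdd : ℂ)
      map_one' := by rw [toAdd_one, rootValue_zero, Units.val_one]
      map_mul' := fun α β => by rw [toAdd_mul, rootValue_add, Units.val_mul] }

lemma evalQ_expQ (a : Torus) (α : RootLattice) : evalQ a (expQ α) = rootValue a α := by
  rw [evalQ, expQ, AddMonoidAlgebra.lift_single, one_smul]
  rfl

lemma isUnit_evalQ {a : Torus} (ha : a ∈ regular) (p : denominators) : IsUnit (evalQ a p) := by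
  obtain ⟨p, hp⟩ := p
  induction hp using Submonoid.closure_induction with
  | mem p hp =>
    obtain ⟨γ, hγ, rfl⟩ := hp
    rw [isUnit_iff_ne_zero, map_sub, map_one, evalQ_expQ, two_nsmul, rootValue_add, ← pow_two,
      sub_ne_zero]
    intro h
    exact ha γ (Or.inr hγ) (Units.ext (by rw [← h, Units.val_one]))
  | one => simp
  | mul p q hp hq h1 h2 =>
    rw [map_mul]
    exact h1.mul h2

/-- Evaluation `f ↦ f(a)` of the elements of `R` at a regular point of the torus. -/
def evalR (a : Torus) (ha : a ∈ regular) : CoeffRing →ₐ[ℂ] ℂ :=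
  IsLocalization.liftAlgHom (M := denominators) (isUnit_evalQ ha)

lemma evalR_algebraMap (a : Torus) (ha : a ∈ regular) (p : AddMonoidAlgebra ℂ RootLattice) :
    evalR a ha (algebraMap _ CoeffRing p) = evalQ a p :=
  IsLocalization.lift_eq ..

/-- The linear map `R ⊗ (U(𝔥) ⊗ U(𝔨) ⊗ U(𝔨)) → U(𝔤)`, `f ⊗ Z ↦ f(a) Γ_a(Z)`. -/
def gamma (a : Torus) (ha : a ∈ regular) :
    CoeffRing ⊗[ℂ] (UCartan ⊗[ℂ] UFixed ⊗[ℂ] UFixed) →ₗ[ℂ] UHat :=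
  TensorProduct.lift
    ((LinearMap.lsmul ℂ UHat).compl₁₂ (evalR a ha).toLinearMap (gammaBase a))

lemma gamma_tmul (a : Torus) (ha : a ∈ regular) (f : CoeffRing)
    (Z : UCartan ⊗[ℂ] UFixed ⊗[ℂ] UFixed) :
    gamma a ha (f ⊗ₜ Z) = evalR a ha f • gammaBase a Z := rfl

end AffineSl2

end

/-!
At a regular point `a` the affine Lie algebra is the direct sum of `𝔨ᵃ`, `𝔥` and `𝔨`: for a root
vector `z` of root `α` and `w = z + θ(z) ∈ 𝔨` one has `(α(a)⁻¹ - α(a)) z = wᵃ - α(a) w`, and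
`α(a)² ≠ 1`. So the map `H ⊗ X ⊗ Y ↦ Xᵃ H Y` ought to be bijective for each regular `a`, with an
inverse whose matrix entries are rational in `a` with poles only where some `α(a)²` equals `1`.

*Uniqueness* needs the injectivity of `gammaBase a`, which would follow from the
Poincaré–Birkhoff–Witt theorem. The proof here goes through comultiplications instead. A linear map
that is compatible with comultiplications, from an algebra generated by a Lie-closed space of
primitive elements over a field of characteristic zero, is injective as soon as it is injective on
`1` and that space (`PrimitivelyGenerated.injective`): an element of least degree in the kernel is
primitive, so that comultiplication followed by multiplication doubles it, while that composite acts
as `2ⁿ` in degree `n`. For `gammaBase a` this leaves only degree one, that is, the directness of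
`𝔨ᵃ + 𝔥 + 𝔨` (`eq_zero_of_Ad_add_add_eq_zero`) and the injectivity of the map from `𝔤` to `U(𝔤)`
(`eq_zero_of_algebraMap_add_ι_hat`). The latter is read off a faithful representation of level one
by differential operators on `ℂ[xₙ, yₙ : n ∈ ℤ]`, modelled on imaginary Verma modules, in which
`tⁿ ⊗ f` is multiplication by `xₙ`. Finally, regular points separate the elements of the coefficient ring
(`eq_zero_of_evalR`).

*Existence* is a sorting argument in the algebra of functions from the regular points to `U(𝔤)`, an
algebra over the coefficient ring. There the constants from `𝔤` lie in the span of `𝔨ᵃ`, `𝔥` and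
`𝔨`, and a product of such factors can be sorted up to products with fewer factors
(`pow_one_sup_le_sortedProducts`).
-/

noncomputable section

namespace AffineSl2

/-! ### Algebras generated by primitive elements -/

section Primitive

section Filtration

variable {K B : Type*} [CommRing K] [Ring B] [Algebra K B]

lemma mem_one_sup_iff {L : Submodule K B} {x : B} :
    x ∈ 1 ⊔ L ↔ ∃ r : K, ∃ z ∈ L, x = algebraMap K B r + z := by
  simp only [Submodule.mem_sup, Submodule.mem_one]
  constructor
  · rintro ⟨_, ⟨r, rfl⟩, z, hz, rfl⟩
    exact ⟨r, z, hz, rfl⟩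
  · rintro ⟨r, z, hz, rfl⟩
    exact ⟨_, ⟨r, rfl⟩, z, hz, rfl⟩

lemma mem_one_sup_of_mem {L : Submodule K B} {z : B} (hz : z ∈ L) : z ∈ 1 ⊔ L :=
  Submodule.mem_sup_right hz

lemma pow_one_sup_mono (L : Submodule K B) {m n : ℕ} (h : m ≤ n) :
    (1 ⊔ L) ^ m ≤ (1 ⊔ L) ^ n :=
  pow_le_pow_right₀ le_sup_left h

lemma one_mem_pow_zero (F : Submodule K B) : (1 : B) ∈ F ^ 0 := by
  rw [pow_zero]
  exact Submodule.one_le.1 le_rfl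

lemma mem_pow_one {F : Submodule K B} {x : B} (hx : x ∈ F) : x ∈ F ^ 1 := by
  rwa [pow_one]

lemma pow_zero_le {F S : Submodule K B} (h : 1 ∈ S) : F ^ 0 ≤ S := by
  rw [pow_zero]
  exact Submodule.one_le.2 h

lemma pow_succ_le {F S : Submodule K B} {n : ℕ} (h : ∀ u ∈ F ^ n, ∀ v ∈ F, u * v ∈ S) :
    F ^ (n + 1) ≤ S := by
  rw [pow_succ]
  exact Submodule.mul_le.2 h

lemma pow_succ_le' {F S : Submodule K B} {n : ℕ} (h : ∀ u ∈ F, ∀ v ∈ F ^ n, u * v ∈ S) :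
    F ^ (n + 1) ≤ S := by
  rw [pow_succ']
  exact Submodule.mul_le.2 h

lemma pow_mono {F G : Submodule K B} (h : F ≤ G) (n : ℕ) : F ^ n ≤ G ^ n :=
  pow_le_pow_left' h n

lemma mul_mem_pow_succ {F : Submodule K B} {n : ℕ} {u v : B} (hu : u ∈ F ^ n) (hv : v ∈ F) :
    u * v ∈ F ^ (n + 1) :=
  pow_succ F n ▸ Submodule.mul_mem_mul hu hv

lemma mul_mem_pow_add {F : Submodule K B} {m n : ℕ} {u v : B} (hu : u ∈ F ^ m)
    (hv : v ∈ F ^ n) : u * v ∈ F ^ (m + n) :=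
  pow_add F m n ▸ Submodule.mul_mem_mul hu hv

/-- Induction along the filtration by powers of `1 ⊔ L`. -/
lemma pow_one_sup_induction {L : Submodule K B} {p : ℕ → B → Prop}
    (scalar : ∀ r : K, p 0 (algebraMap K B r))
    (add : ∀ n x y, p n x → p n y → p n (x + y))
    (mul : ∀ n x (r : K), ∀ z ∈ L, x ∈ (1 ⊔ L) ^ n → p n x →
      p (n + 1) (x * (algebraMap K B r + z)))
    {n : ℕ} {x : B} (hx : x ∈ (1 ⊔ L) ^ n) : p n x := by
  induction n generalizing x with
  | zero =>
    rw [pow_zero, Submodule.mem_one] at hx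
    obtain ⟨r, rfl⟩ := hx
    exact scalar r
  | succ n ih =>
    rw [pow_succ] at hx
    induction hx using Submodule.mul_induction_on' with
    | mem_mul_mem u hu v hv =>
      obtain ⟨r, z, hz, rfl⟩ := mem_one_sup_iff.1 hv
      exact mul n u r z hz hu (ih hu)
    | add u _ v _ hu hv => exact add _ _ _ hu hv

lemma exists_mem_pow_one_sup {L : Submodule K B} (hL : Algebra.adjoin K (L : Set B) = ⊤) (x : B) :
    ∃ n, x ∈ (1 ⊔ L) ^ n := by
  have hx : x ∈ Algebra.adjoin K (L : Set B) := hL ▸ Algebra.mem_top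
  induction hx using Algebra.adjoin_induction with
  | mem x hx => exact ⟨1, mem_pow_one (mem_one_sup_of_mem hx)⟩
  | algebraMap r => exact ⟨0, by simp⟩
  | add x y _ _ hx hy =>
    obtain ⟨m, hm⟩ := hx
    obtain ⟨n, hn⟩ := hy
    exact ⟨max m n, add_mem (pow_one_sup_mono L (le_max_left m n) hm)
      (pow_one_sup_mono L (le_max_right m n) hn)⟩
  | mul x y _ _ hx hy =>
    obtain ⟨m, hm⟩ := hx
    obtain ⟨n, hn⟩ := hy
    exact ⟨m + n, mul_mem_pow_add hm hn⟩

/-- Commutators with an element of `L` preserve the filtration by powers of `1 ⊔ L`. -/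
lemma commutator_mem_pow {L : Submodule K B} (hL : ∀ z ∈ L, ∀ w ∈ L, z * w - w * z ∈ L) {z : B}
    (hz : z ∈ L) {n : ℕ} {x : B} (hx : x ∈ (1 ⊔ L) ^ n) : z * x - x * z ∈ (1 ⊔ L) ^ n := by
  refine pow_one_sup_induction (p := fun n x => z * x - x * z ∈ (1 ⊔ L) ^ n) ?_ ?_ ?_ hx
  · intro r
    rw [← Algebra.commutes r z, sub_self]
    exact zero_mem _
  · intro n x y hx hy
    convert add_mem hx hy using 1
    noncomm_ring
  · intro n x r w hw hx h
    have e : z * (x * (algebraMap K B r + w)) - x * (algebraMap K B r + w) * z =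
        (z * x - x * z) * (algebraMap K B r + w) + x * (z * w - w * z) := by
      have := Algebra.commutes r z
      simp only [mul_add, add_mul, sub_mul, mul_sub, mul_assoc, this]
      abel
    rw [e]
    exact add_mem (mul_mem_pow_succ h (mem_one_sup_iff.2 ⟨r, w, hw, rfl⟩))
      (mul_mem_pow_succ hx (mem_one_sup_of_mem (hL z hz w hw)))

end Filtration

variable {K : Type*} [Field K] {A B C D : Type*} [Ring A] [Algebra K A] [Ring B] [Algebra K B]
  [Ring C] [Algebra K C] [AddCommGroup D] [Module K D]

/-- The algebra `B`, with comultiplication `Δ`, is generated by a space `L` of primitive elements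
which is closed under commutators. Neither coassociativity of `Δ` nor a counit is required. -/
structure PrimitivelyGenerated (Δ : B →ₐ[K] B ⊗[K] B) (L : Submodule K B) : Prop where
  comul_eq : ∀ z ∈ L, Δ z = z ⊗ₜ 1 + 1 ⊗ₜ z
  commutator_mem : ∀ z ∈ L, ∀ w ∈ L, z * w - w * z ∈ L
  adjoin_eq_top : Algebra.adjoin K (L : Set B) = ⊤

/-- The tensors of total degree at most `n` with respect to the filtration by powers of `F`. -/
def tensorFiltration (F : Submodule K B) (n : ℕ) : Submodule K (B ⊗[K] B) :=
  Submodule.span K {w | ∃ i j, i + j = n ∧ ∃ a ∈ F ^ i, ∃ b ∈ F ^ j, w = a ⊗ₜ b}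

lemma tmul_mem_tensorFiltration {F : Submodule K B} {i j n : ℕ} (h : i + j = n) {a b : B}
    (ha : a ∈ F ^ i) (hb : b ∈ F ^ j) : a ⊗ₜ[K] b ∈ tensorFiltration F n :=
  Submodule.subset_span ⟨i, j, h, a, ha, b, hb, rfl⟩

lemma comul_mem_tensorFiltration {Δ : B →ₐ[K] B ⊗[K] B} {L : Submodule K B}
    (hL : ∀ z ∈ L, Δ z = z ⊗ₜ 1 + 1 ⊗ₜ z) {n : ℕ} {x : B} (hx : x ∈ (1 ⊔ L) ^ n) :
    Δ x ∈ tensorFiltration (1 ⊔ L) n := by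
  refine pow_one_sup_induction (p := fun n x => Δ x ∈ tensorFiltration (1 ⊔ L) n) ?_ ?_ ?_ hx
  · intro r
    rw [AlgHom.commutes, Algebra.TensorProduct.algebraMap_apply]
    exact tmul_mem_tensorFiltration (i := 0) (j := 0) rfl (by simp) (one_mem_pow_zero _)
  · intro n x y hx hy
    rw [map_add]
    exact add_mem hx hy
  · intro n x r z hz _ h
    rw [map_mul, map_add, AlgHom.commutes, hL z hz]
    generalize Δ x = w at h
    rw [tensorFiltration] at h
    induction h using Submodule.span_induction with
    | zero => rw [zero_mul]; exact zero_mem _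
    | add w v _ _ hw hv => rw [add_mul]; exact add_mem hw hv
    | smul c w _ hw => rw [smul_mul_assoc]; exact Submodule.smul_mem _ _ hw
    | mem w hw =>
      obtain ⟨i, j, rfl, a, ha, b, hb, rfl⟩ := hw
      have hr : (algebraMap K B r) ∈ (1 ⊔ L : Submodule K B) :=
        Submodule.mem_sup_left (by simp)
      simp only [mul_add, Algebra.TensorProduct.algebraMap_apply,
        Algebra.TensorProduct.tmul_mul_tmul, mul_one]
      exact add_mem (tmul_mem_tensorFiltration (by omega) (mul_mem_pow_succ ha hr) hb)
        (add_mem (tmul_mem_tensorFiltration (by omega)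
            (mul_mem_pow_succ ha (mem_one_sup_of_mem hz)) hb)
          (tmul_mem_tensorFiltration (i := i) (j := j + 1) (by omega) ha
            (mul_mem_pow_succ hb (mem_one_sup_of_mem hz))))

/-- Comultiplication followed by multiplication acts as `2ⁿ` on the `n`-th graded piece of the
filtration by powers of `1 ⊔ L`. -/
lemma mul_comul_sub_two_pow_mem {Δ : B →ₐ[K] B ⊗[K] B} {L : Submodule K B}
    (h : PrimitivelyGenerated Δ L) {n : ℕ} {x : B} (hx : x ∈ (1 ⊔ L) ^ (n + 1)) :
    LinearMap.mul' K B (Δ x) - (2 : K) ^ (n + 1) • x ∈ (1 ⊔ L) ^ n := by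
  -- The defect `a ⊗ b ↦ a (z b - b z)` of the multiplication against right multiplication by `z`.
  have defect : ∀ z ∈ L, ∀ n, ∀ w ∈ tensorFiltration (1 ⊔ L) n,
      LinearMap.mul' K B (w * z ⊗ₜ 1) - LinearMap.mul' K B w * z ∈ (1 ⊔ L) ^ n := by
    intro z hz n w hw
    rw [tensorFiltration] at hw
    induction hw using Submodule.span_induction with
    | zero => simp
    | add w v _ _ hw hv =>
      convert add_mem hw hv using 1
      simp only [add_mul, map_add]
      abel
    | smul c w _ hw =>
      convert Submodule.smul_mem _ c hw using 1
      simp only [smul_mul_assoc, map_smul, smul_sub]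
    | mem w hw =>
      obtain ⟨i, j, rfl, a, ha, b, hb, rfl⟩ := hw
      convert mul_mem_pow_add ha (commutator_mem_pow h.commutator_mem hz hb) using 1
      simp only [Algebra.TensorProduct.tmul_mul_tmul, LinearMap.mul'_apply, mul_one, mul_sub,
        mul_assoc]
  have right : ∀ (w : B ⊗[K] B) (z : B),
      LinearMap.mul' K B (w * 1 ⊗ₜ z) = LinearMap.mul' K B w * z := by
    intro w z
    induction w using TensorProduct.induction_on with
    | zero => simp
    | tmul a b => simp [mul_assoc]
    | add a b ha hb => simp only [add_mul, map_add, ha, hb]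
  induction n generalizing x with
  | zero =>
    rw [zero_add, pow_one] at hx
    obtain ⟨r, z, hz, rfl⟩ := mem_one_sup_iff.1 hx
    rw [pow_zero, Submodule.mem_one]
    refine ⟨-r, ?_⟩
    simp only [map_add, AlgHom.commutes, h.comul_eq z hz, LinearMap.mul'_apply,
      Algebra.TensorProduct.algebraMap_apply, mul_one, one_mul, zero_add, pow_one, two_smul,
      map_neg]
    abel
  | succ n ih =>
    rw [pow_succ] at hx
    induction hx using Submodule.mul_induction_on' with
    | add u _ v _ hu hv =>
      convert add_mem hu hv using 1
      simp only [map_add, smul_add]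
      abel
    | mem_mul_mem u hu v hv =>
      obtain ⟨r, z, hz, rfl⟩ := mem_one_sup_iff.1 hv
      have h1 := ih hu
      have h2 := defect z hz _ _ (comul_mem_tensorFiltration h.comul_eq hu)
      have h3 := mul_mem_pow_succ h1 (mem_one_sup_of_mem hz)
      have h4 := pow_one_sup_mono L n.le_succ h1
      have key : LinearMap.mul' K B (Δ (u * (algebraMap K B r + z))) -
          (2 : K) ^ (n + 1 + 1) • (u * (algebraMap K B r + z)) =
          (LinearMap.mul' K B (Δ u * z ⊗ₜ 1) - LinearMap.mul' K B (Δ u) * z) +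
          (2 : K) • ((LinearMap.mul' K B (Δ u) - (2 : K) ^ (n + 1) • u) * z) +
          r • (LinearMap.mul' K B (Δ u) - (2 : K) ^ (n + 1) • u) - (r * 2 ^ (n + 1)) • u := by
        have e1 : LinearMap.mul' K B (Δ (u * (algebraMap K B r + z))) =
            r • LinearMap.mul' K B (Δ u) + (LinearMap.mul' K B (Δ u * z ⊗ₜ 1) +
              LinearMap.mul' K B (Δ u) * z) := by
          rw [map_mul, map_add, AlgHom.commutes, h.comul_eq z hz, mul_add, mul_add, map_add,
            map_add, right, ← Algebra.commutes, ← Algebra.smul_def, map_smul]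
        rw [e1, mul_add, ← Algebra.commutes, ← Algebra.smul_def, sub_mul, smul_mul_assoc]
        module
      rw [key]
      exact sub_mem (add_mem (add_mem h2 (Submodule.smul_mem _ _ h3)) (Submodule.smul_mem _ _ h4))
        (Submodule.smul_mem _ _ hu)

/-- Up to tensors of lower degree in both factors, every element is primitive. -/
lemma comul_sub_mem_map₂ {Δ : B →ₐ[K] B ⊗[K] B} {L : Submodule K B}
    (hL : ∀ z ∈ L, Δ z = z ⊗ₜ 1 + 1 ⊗ₜ z) {n : ℕ} {x : B} (hx : x ∈ (1 ⊔ L) ^ (n + 1)) :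
    Δ x - (x ⊗ₜ 1 + 1 ⊗ₜ x) ∈
      Submodule.map₂ (TensorProduct.mk K B B) ((1 ⊔ L) ^ n) ((1 ⊔ L) ^ n) := by
  induction n generalizing x with
  | zero =>
    rw [zero_add, pow_one] at hx
    obtain ⟨r, z, hz, rfl⟩ := mem_one_sup_iff.1 hx
    have e : Δ (algebraMap K B r + z) -
        ((algebraMap K B r + z) ⊗ₜ 1 + 1 ⊗ₜ (algebraMap K B r + z)) =
        TensorProduct.mk K B B (algebraMap K B (-r)) 1 := by
      rw [map_add, AlgHom.commutes, hL z hz, Algebra.TensorProduct.algebraMap_apply,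
        TensorProduct.mk_apply, map_neg, TensorProduct.neg_tmul, TensorProduct.add_tmul,
        TensorProduct.tmul_add, Algebra.algebraMap_eq_smul_one, TensorProduct.tmul_smul,
        TensorProduct.smul_tmul']
      abel
    rw [e]
    exact Submodule.apply_mem_map₂ _ (by simp) (one_mem_pow_zero _)
  | succ n ih =>
    rw [pow_succ] at hx
    induction hx using Submodule.mul_induction_on' with
    | add u _ v _ hu hv =>
      convert add_mem hu hv using 1
      simp only [map_add, TensorProduct.add_tmul, TensorProduct.tmul_add]
      abel
    | mem_mul_mem u hu v hv =>
      obtain ⟨r, z, hz, rfl⟩ := mem_one_sup_iff.1 hv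
      have hz' : z ∈ (1 ⊔ L) ^ (n + 1) :=
        pow_one_sup_mono L (Nat.le_add_left 1 n) (by simpa using mem_one_sup_of_mem hz)
      set M := Submodule.map₂ (TensorProduct.mk K B B) ((1 ⊔ L) ^ (n + 1)) ((1 ⊔ L) ^ (n + 1))
      have hM : ∀ w ∈ Submodule.map₂ (TensorProduct.mk K B B) ((1 ⊔ L) ^ n) ((1 ⊔ L) ^ n),
          w ∈ M ∧ w * (z ⊗ₜ 1 + 1 ⊗ₜ z) ∈ M := by
        intro w hw
        have hle := pow_one_sup_mono L n.le_succ
        refine ⟨Submodule.map₂_le_map₂ hle hle hw, ?_⟩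
        suffices Submodule.map₂ (TensorProduct.mk K B B) ((1 ⊔ L) ^ n) ((1 ⊔ L) ^ n) ≤
            M.comap (LinearMap.mulRight K (z ⊗ₜ 1 + 1 ⊗ₜ z)) from this hw
        rw [Submodule.map₂_le]
        intro a ha b hb
        rw [Submodule.mem_comap, LinearMap.mulRight_apply, TensorProduct.mk_apply, mul_add,
          Algebra.TensorProduct.tmul_mul_tmul, Algebra.TensorProduct.tmul_mul_tmul, mul_one,
          mul_one]
        exact add_mem
          (Submodule.apply_mem_map₂ _ (mul_mem_pow_succ ha (mem_one_sup_of_mem hz)) (hle hb))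
          (Submodule.apply_mem_map₂ _ (hle ha) (mul_mem_pow_succ hb (mem_one_sup_of_mem hz)))
      have key : Δ (u * (algebraMap K B r + z)) -
          ((u * (algebraMap K B r + z)) ⊗ₜ 1 + 1 ⊗ₜ (u * (algebraMap K B r + z))) =
          r • (Δ u - (u ⊗ₜ 1 + 1 ⊗ₜ u)) + (Δ u - (u ⊗ₜ 1 + 1 ⊗ₜ u)) * (z ⊗ₜ 1 + 1 ⊗ₜ z) +
          (TensorProduct.mk K B B u z + TensorProduct.mk K B B z u) := by
        rw [map_mul, map_add, AlgHom.commutes, hL z hz, mul_add, mul_add u, ← Algebra.commutes r u,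
          ← Algebra.commutes r (Δ u), ← Algebra.smul_def, ← Algebra.smul_def]
        simp only [sub_mul, add_mul, mul_add, Algebra.TensorProduct.tmul_mul_tmul, mul_one, one_mul,
          TensorProduct.mk_apply, TensorProduct.add_tmul, TensorProduct.tmul_add,
          ← TensorProduct.smul_tmul', TensorProduct.tmul_smul]
        module
      rw [key]
      have h := hM _ (ih hu)
      exact add_mem (add_mem (Submodule.smul_mem _ _ h.1) h.2)
        (add_mem (Submodule.apply_mem_map₂ _ hu hz') (Submodule.apply_mem_map₂ _ hz' hu))

/-- A map compatible with comultiplications is injective as soon as it is injective on `1` and the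
primitive generators: an element of the kernel of least degree would be primitive, and
comultiplication followed by multiplication multiplies it both by `2` and, up to lower degree,
by `2ⁿ`, so that its degree is at most one. -/
theorem PrimitivelyGenerated.injective [CharZero K] {Δ : B →ₐ[K] B ⊗[K] B} {L : Submodule K B}
    (h : PrimitivelyGenerated Δ L) {ΔD : D →ₗ[K] D ⊗[K] D} {f : B →ₗ[K] D}
    (hf : ∀ x, ΔD (f x) = TensorProduct.map f f (Δ x))
    (hinj : ∀ (r : K), ∀ z ∈ L, f (algebraMap K B r + z) = 0 → algebraMap K B r + z = 0) :
    Function.Injective f := by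
  have key : ∀ n, ∀ x ∈ (1 ⊔ L) ^ (n + 1), f x = 0 → x = 0 := by
    intro n
    induction n with
    | zero =>
      intro x hx h0
      rw [zero_add, pow_one] at hx
      obtain ⟨r, z, hz, rfl⟩ := mem_one_sup_iff.1 hx
      exact hinj r z hz h0
    | succ n ih =>
      intro x hx h0
      set F : Submodule K B := (1 ⊔ L) ^ (n + 1) with hF
      have hw := comul_sub_mem_map₂ h.comul_eq hx
      have hw0 : TensorProduct.map f f (Δ x - (x ⊗ₜ 1 + 1 ⊗ₜ x)) = 0 := by
        simp [← hf, h0]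
      have prim : Δ x - (x ⊗ₜ 1 + 1 ⊗ₜ x) = 0 := by
        rw [← hF, ← Submodule.range_subtype F, ← TensorProduct.range_map] at hw
        obtain ⟨v, hv⟩ := hw
        rw [← hv] at hw0 ⊢
        have hfi : Function.Injective (f ∘ₗ F.subtype) := by
          rw [injective_iff_map_eq_zero]
          intro y hy
          exact Subtype.ext (ih y y.2 hy)
        have := TensorProduct.map_injective_of_flat_flat _ _ hfi hfi
        rw [TensorProduct.map_comp] at this
        rw [(injective_iff_map_eq_zero _).1 this v hw0, map_zero]
      have h2 := mul_comul_sub_two_pow_mem h hx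
      rw [sub_eq_zero.1 prim] at h2
      simp only [map_add, LinearMap.mul'_apply, mul_one, one_mul] at h2
      rw [← two_smul K x, ← sub_smul] at h2
      have hne : (2 : K) - 2 ^ (n + 1 + 1) ≠ 0 := by
        rw [sub_ne_zero]
        intro h
        have h' : (2 : ℕ) ^ 1 = 2 ^ (n + 1 + 1) := by exact_mod_cast h
        have := Nat.pow_right_injective le_rfl h'
        omega
      exact ih x ((Submodule.smul_mem_iff _ hne).1 h2) h0
  rw [injective_iff_map_eq_zero]
  intro x hx
  obtain ⟨n, hn⟩ := exists_mem_pow_one_sup h.adjoin_eq_top x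
  exact key n x (pow_one_sup_mono L n.le_succ hn) hx

/-- The comultiplication of a tensor product. -/
def tensorComul (ΔA : A →ₐ[K] A ⊗[K] A) (ΔB : B →ₐ[K] B ⊗[K] B) :
    A ⊗[K] B →ₐ[K] (A ⊗[K] B) ⊗[K] (A ⊗[K] B) :=
  (Algebra.TensorProduct.tensorTensorTensorComm K K K K A A B B).toAlgHom.comp
    (Algebra.TensorProduct.map ΔA ΔB)

lemma tensorComul_tmul (ΔA : A →ₐ[K] A ⊗[K] A) (ΔB : B →ₐ[K] B ⊗[K] B) (a : A) (b : B) :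
    tensorComul ΔA ΔB (a ⊗ₜ b) =
      Algebra.TensorProduct.tensorTensorTensorComm K K K K A A B B (ΔA a ⊗ₜ ΔB b) := rfl

theorem PrimitivelyGenerated.tensor {ΔA : A →ₐ[K] A ⊗[K] A} {ΔB : B →ₐ[K] B ⊗[K] B}
    {LA : Submodule K A} {LB : Submodule K B} (hA : PrimitivelyGenerated ΔA LA)
    (hB : PrimitivelyGenerated ΔB LB) :
    PrimitivelyGenerated (tensorComul ΔA ΔB)
      (LA.map (Algebra.TensorProduct.includeLeft : A →ₐ[K] A ⊗[K] B).toLinearMap ⊔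
        LB.map (Algebra.TensorProduct.includeRight : B →ₐ[K] A ⊗[K] B).toLinearMap) where
  comul_eq z hz := by
    obtain ⟨_, ⟨a, ha, rfl⟩, _, ⟨b, hb, rfl⟩, rfl⟩ := Submodule.mem_sup.1 hz
    simp only [AlgHom.toLinearMap_apply, Algebra.TensorProduct.includeLeft_apply,
      Algebra.TensorProduct.includeRight_apply, map_add, tensorComul_tmul, map_one,
      hA.comul_eq a ha, hB.comul_eq b hb, Algebra.TensorProduct.one_def, TensorProduct.add_tmul,
      TensorProduct.tmul_add, Algebra.TensorProduct.tensorTensorTensorComm_tmul]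
    abel
  commutator_mem z hz w hw := by
    obtain ⟨_, ⟨a, ha, rfl⟩, _, ⟨b, hb, rfl⟩, rfl⟩ := Submodule.mem_sup.1 hz
    obtain ⟨_, ⟨a', ha', rfl⟩, _, ⟨b', hb', rfl⟩, rfl⟩ := Submodule.mem_sup.1 hw
    refine Submodule.mem_sup.2 ⟨_, ⟨_, hA.commutator_mem a ha a' ha', rfl⟩, _,
      ⟨_, hB.commutator_mem b hb b' hb', rfl⟩, ?_⟩
    simp only [AlgHom.toLinearMap_apply, Algebra.TensorProduct.includeLeft_apply,
      Algebra.TensorProduct.includeRight_apply, mul_add, add_mul, TensorProduct.sub_tmul,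
      TensorProduct.tmul_sub, Algebra.TensorProduct.tmul_mul_tmul, one_mul, mul_one]
    abel
  adjoin_eq_top := by
    rw [eq_top_iff]
    set S := Algebra.adjoin K
      ((LA.map (Algebra.TensorProduct.includeLeft : A →ₐ[K] A ⊗[K] B).toLinearMap ⊔
        LB.map (Algebra.TensorProduct.includeRight : B →ₐ[K] A ⊗[K] B).toLinearMap :
          Submodule K (A ⊗[K] B)) : Set (A ⊗[K] B))
    have h1 : ∀ a : A, a ⊗ₜ 1 ∈ S := by
      intro a
      have : Algebra.adjoin K (LA : Set A) ≤
          S.comap (Algebra.TensorProduct.includeLeft : A →ₐ[K] A ⊗[K] B) :=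
        Algebra.adjoin_le fun x hx =>
          Algebra.subset_adjoin (Submodule.mem_sup_left (Submodule.mem_map_of_mem hx))
      rw [hA.adjoin_eq_top] at this
      exact this Algebra.mem_top
    have h2 : ∀ b : B, 1 ⊗ₜ b ∈ S := by
      intro b
      have : Algebra.adjoin K (LB : Set B) ≤
          S.comap (Algebra.TensorProduct.includeRight : B →ₐ[K] A ⊗[K] B) :=
        Algebra.adjoin_le fun x hx =>
          Algebra.subset_adjoin (Submodule.mem_sup_right (Submodule.mem_map_of_mem hx))
      rw [hB.adjoin_eq_top] at this
      exact this Algebra.mem_top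
    intro w _
    induction w using TensorProduct.induction_on with
    | zero => exact zero_mem S
    | add x y hx hy => exact add_mem (hx trivial) (hy trivial)
    | tmul a b =>
      have := mul_mem (h1 a) (h2 b)
      rwa [Algebra.TensorProduct.tmul_mul_tmul, one_mul, mul_one] at this

/-- The product of two maps into an algebra that are compatible with the comultiplications is
compatible with them. -/
lemma comul_mul_eq_map {ΔA : A →ₐ[K] A ⊗[K] A} {ΔB : B →ₐ[K] B ⊗[K] B} {ΔC : C →ₐ[K] C ⊗[K] C}
    {f : A →ₗ[K] C} {g : B →ₗ[K] C} {m : A ⊗[K] B →ₗ[K] C}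
    (hf : ∀ a, ΔC (f a) = TensorProduct.map f f (ΔA a))
    (hg : ∀ b, ΔC (g b) = TensorProduct.map g g (ΔB b))
    (hm : (∀ a b, m (a ⊗ₜ b) = f a * g b) ∨ ∀ a b, m (a ⊗ₜ b) = g b * f a) (x : A ⊗[K] B) :
    ΔC (m x) = TensorProduct.map m m (tensorComul ΔA ΔB x) := by
  induction x using TensorProduct.induction_on with
  | zero => simp
  | add x y hx hy => simp only [map_add, hx, hy]
  | tmul a b =>
    rw [tensorComul_tmul]
    rcases hm with hm | hm
    · rw [hm, map_mul, hf, hg]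
      generalize ΔA a = u
      generalize ΔB b = v
      induction u using TensorProduct.induction_on with
      | zero => simp
      | add x y hx hy => simp only [map_add, add_mul, TensorProduct.add_tmul, hx, hy]
      | tmul a a' =>
        induction v using TensorProduct.induction_on with
        | zero => simp
        | add x y hx hy => simp only [map_add, mul_add, TensorProduct.tmul_add, hx, hy]
        | tmul b b' => simp [hm]
    · rw [hm, map_mul, hf, hg]
      generalize ΔA a = u
      generalize ΔB b = v
      induction u using TensorProduct.induction_on with
      | zero => simp
      | add x y hx hy => simp only [map_add, mul_add, TensorProduct.add_tmul, hx, hy]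
      | tmul a a' =>
        induction v using TensorProduct.induction_on with
        | zero => simp
        | add x y hx hy => simp only [map_add, add_mul, TensorProduct.tmul_add, hx, hy]
        | tmul b b' => simp [hm]

end Primitive

/-! ### The coalgebra structure of enveloping algebras -/

section Enveloping

attribute [local instance] LieRing.ofAssociativeRing

open UniversalEnvelopingAlgebra (ι)

variable {K L L' : Type*} [Field K] [LieRing L] [LieAlgebra K L] [LieRing L'] [LieAlgebra K L']

lemma adjoin_range_ι :
    Algebra.adjoin K (LinearMap.range (ι K (L := L) : L →ₗ[K] UniversalEnvelopingAlgebra K L) :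
      Set (UniversalEnvelopingAlgebra K L)) = ⊤ := by
  set S := Algebra.adjoin K (LinearMap.range (ι K (L := L) :
    L →ₗ[K] UniversalEnvelopingAlgebra K L) : Set (UniversalEnvelopingAlgebra K L)) with hS
  have hmem : ∀ x : L, ι K x ∈ S := fun x => Algebra.subset_adjoin ⟨x, rfl⟩
  let g : L →ₗ⁅K⁆ S :=
    { toFun := fun x => ⟨ι K x, hmem x⟩
      map_add' := fun x y => Subtype.ext (map_add _ x y)
      map_smul' := fun r x => Subtype.ext (map_smul _ r x)
      map_lie' := fun {x y} => Subtype.ext (LieHom.map_lie _ x y) }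
  have hid : S.val.comp (UniversalEnvelopingAlgebra.lift K g) = AlgHom.id K _ := by
    apply UniversalEnvelopingAlgebra.hom_ext
    ext x
    change S.val (UniversalEnvelopingAlgebra.lift K g (ι K x)) = ι K x
    rw [UniversalEnvelopingAlgebra.lift_ι_apply]
    rfl
  rw [eq_top_iff]
  intro x _
  have := DFunLike.congr_fun hid x
  rw [AlgHom.id_apply] at this
  rw [← this]
  exact (UniversalEnvelopingAlgebra.lift K g x).2

lemma ι_lie (x y : L) : ι K ⁅x, y⁆ = ι K x * ι K y - ι K y * ι K x :=
  LieHom.map_lie _ x y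

@[elab_as_elim]
lemma enveloping_induction {p : UniversalEnvelopingAlgebra K L → Prop}
    (one : p 1) (smul : ∀ (r : K) X, p X → p (r • X)) (ι_mul : ∀ x X, p X → p (ι K x * X))
    (add : ∀ X Y, p X → p Y → p (X + Y)) (X : UniversalEnvelopingAlgebra K L) : p X := by
  have hX : X ∈ Algebra.adjoin K (LinearMap.range (ι K (L := L) :
      L →ₗ[K] UniversalEnvelopingAlgebra K L) : Set (UniversalEnvelopingAlgebra K L)) := by
    rw [adjoin_range_ι]; exact Algebra.mem_top
  have key : ∀ Y, p Y → p (X * Y) := by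
    induction hX using Algebra.adjoin_induction with
    | mem x hx =>
      obtain ⟨x, rfl⟩ := hx
      exact ι_mul x
    | algebraMap r =>
      intro Y hY
      rw [← Algebra.smul_def]
      exact smul r Y hY
    | add X Y _ _ hX hY =>
      intro Z hZ
      rw [add_mul]
      exact add _ _ (hX Z hZ) (hY Z hZ)
    | mul X Y _ _ hX hY =>
      intro Z hZ
      rw [mul_assoc]
      exact hX _ (hY Z hZ)
  simpa using key 1 one

/-- The comultiplication of the enveloping algebra, for which the elements of the Lie algebra are
primitive. -/
def comul : UniversalEnvelopingAlgebra K L →ₐ[K]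
    UniversalEnvelopingAlgebra K L ⊗[K] UniversalEnvelopingAlgebra K L :=
  UniversalEnvelopingAlgebra.lift K
    { toFun := fun x => ι K x ⊗ₜ 1 + 1 ⊗ₜ ι K x
      map_add' := fun x y => by
        simp only [map_add, TensorProduct.add_tmul, TensorProduct.tmul_add]; abel
      map_smul' := fun r x => by
        simp only [map_smul, TensorProduct.smul_tmul', TensorProduct.tmul_smul, smul_add,
          RingHom.id_apply]
      map_lie' := fun {x y} => by
        simp only [LieHom.map_lie, LieRing.of_associative_ring_bracket, mul_add, add_mul,
          Algebra.TensorProduct.tmul_mul_tmul, one_mul, mul_one, TensorProduct.sub_tmul,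
          TensorProduct.tmul_sub]
        abel }

lemma comul_ι (x : L) : comul (ι K x) = ι K x ⊗ₜ 1 + 1 ⊗ₜ ι K x :=
  UniversalEnvelopingAlgebra.lift_ι_apply ..

theorem primitivelyGenerated_enveloping :
    PrimitivelyGenerated (comul : UniversalEnvelopingAlgebra K L →ₐ[K] _)
      (LinearMap.range (ι K (L := L) : L →ₗ[K] UniversalEnvelopingAlgebra K L)) where
  comul_eq := by
    rintro _ ⟨x, rfl⟩
    exact comul_ι x
  commutator_mem := by
    rintro _ ⟨x, rfl⟩ _ ⟨y, rfl⟩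
    exact ⟨⁅x, y⁆, LieHom.map_lie _ x y⟩
  adjoin_eq_top := adjoin_range_ι

/-- Algebra homomorphisms of enveloping algebras that are induced by maps of Lie algebras are
compatible with the comultiplications. -/
lemma comul_algHom (F : UniversalEnvelopingAlgebra K L →ₐ[K] UniversalEnvelopingAlgebra K L')
    (hF : ∀ x, ∃ y, F (ι K x) = ι K y) (X : UniversalEnvelopingAlgebra K L) :
    comul (F X) = TensorProduct.map F.toLinearMap F.toLinearMap (comul X) := by
  have : comul.comp F = (Algebra.TensorProduct.map F F).comp comul := by
    apply UniversalEnvelopingAlgebra.hom_ext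
    ext x
    obtain ⟨y, hy⟩ := hF x
    change comul (F (ι K x)) = Algebra.TensorProduct.map F F (comul (ι K x))
    rw [comul_ι, hy, comul_ι, map_add, Algebra.TensorProduct.map_tmul,
      Algebra.TensorProduct.map_tmul, hy, map_one]
  exact DFunLike.congr_fun this X

/-- The scalars are detected by the augmentation, which kills the Lie algebra. -/
lemma eq_zero_of_algebraMap_add_ι_eq_zero {r : K} {x : L}
    (h : algebraMap K (UniversalEnvelopingAlgebra K L) r + ι K x = 0) : r = 0 := by
  have := congrArg (UniversalEnvelopingAlgebra.lift K (0 : L →ₗ⁅K⁆ K)) h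
  rwa [map_add, AlgHom.commutes, UniversalEnvelopingAlgebra.lift_ι_apply, LieHom.zero_apply,
    add_zero, map_zero] at this

end Enveloping

/-! ### A faithful representation of level one -/

section Representation

attribute [local instance] LieRing.ofAssociativeRing

open MvPolynomial (X C mkDerivation pderiv rename)

/-- The polynomial ring `ℂ[xₙ, yₙ : n ∈ ℤ]`, with `xₙ = X (inl n)` and `yₙ = X (inr n)`. -/
abbrev Pol : Type := MvPolynomial (ℤ ⊕ ℤ) ℂ

/-- The linear endomorphisms of `ℂ[xₙ, yₙ]`. -/
abbrev EndPol : Type := Module.End ℂ Pol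

/-- Multiplication by a polynomial. -/
abbrev mulLeft (a : Pol) : EndPol := LinearMap.mulLeft ℂ a

/-- Partial derivatives of `ℂ[xₙ, yₙ]`. -/
def partialX (i : ℤ ⊕ ℤ) : Derivation ℂ Pol Pol := pderiv i

/-- A derivation as a linear endomorphism. -/
abbrev derOp (δ : Derivation ℂ Pol Pol) : EndPol := δ.toLinearMap

/-- The derivation `xₖ ↦ xₖ₊ₘ`, `yₖ ↦ 0`. -/
def shift (m : ℤ) : Derivation ℂ Pol Pol :=
  mkDerivation ℂ (Sum.elim (fun k => X (Sum.inl (k + m))) 0)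

/-- The gradient with respect to the variables `xₖ`, which has finite support. -/
def gradX : Derivation ℂ Pol (ℤ →₀ Pol) :=
  mkDerivation ℂ (Sum.elim (fun k => Finsupp.single k 1) 0)

/-- The operator `yₙ + n ∂/∂y₋ₙ`; these operators satisfy the relations of a Heisenberg algebra. -/
def boson (n : ℤ) : EndPol :=
  mulLeft (X (Sum.inr n)) + (n : ℂ) • derOp (partialX (Sum.inr (-n)))

/-- The action of `tⁿ ⊗ f`, multiplication by `xₙ`. -/
def opF (n : ℤ) : EndPol := mulLeft (X (Sum.inl n))

/-- The action of `tⁿ ⊗ h`. -/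
def opH (n : ℤ) : EndPol := boson n - (2 : ℂ) • derOp (shift n)

/-- The action of `tⁿ ⊗ e`, the second order operator
`∑ₖ (yₙ₊ₖ + (n + k) ∂/∂y₋ₙ₋ₖ - ∑ₘ xₘ₊ₙ₊ₖ ∂/∂xₘ) ∂/∂xₖ + n ∂/∂x₋ₙ`. -/
def opE (n : ℤ) : EndPol :=
  (Finsupp.lsum ℂ fun k => boson (n + k) - derOp (shift (n + k))) ∘ₗ
    (gradX : Pol →ₗ[ℂ] ℤ →₀ Pol) + (n : ℂ) • derOp (partialX (Sum.inl (-n)))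

/-- The action of `d`, the derivation `xₖ ↦ k xₖ`, `yₖ ↦ k yₖ`. -/
def opD : Derivation ℂ Pol Pol :=
  mkDerivation ℂ (Sum.elim (fun k => (k : ℂ) • X (Sum.inl k)) fun k => (k : ℂ) • X (Sum.inr k))

@[simp] lemma shift_X_inl (m k : ℤ) : shift m (X (Sum.inl k)) = X (Sum.inl (k + m)) := by
  simp [shift, MvPolynomial.mkDerivation_X]

@[simp] lemma shift_X_inr (m k : ℤ) : shift m (X (Sum.inr k)) = 0 := by
  simp [shift, MvPolynomial.mkDerivation_X]

@[simp] lemma gradX_X_inl (k : ℤ) : gradX (X (Sum.inl k)) = Finsupp.single k 1 := by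
  simp [gradX, MvPolynomial.mkDerivation_X]

@[simp] lemma gradX_X_inr (k : ℤ) : gradX (X (Sum.inr k)) = 0 := by
  simp [gradX, MvPolynomial.mkDerivation_X]

@[simp] lemma opD_X_inl (k : ℤ) : opD (X (Sum.inl k)) = (k : ℂ) • X (Sum.inl k) := by
  simp [opD, MvPolynomial.mkDerivation_X]

@[simp] lemma opD_X_inr (k : ℤ) : opD (X (Sum.inr k)) = (k : ℂ) • X (Sum.inr k) := by
  simp [opD, MvPolynomial.mkDerivation_X]

lemma boson_apply (n : ℤ) (q : Pol) :
    boson n q = X (Sum.inr n) * q + (n : ℂ) • partialX (Sum.inr (-n)) q := rfl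

lemma opF_apply (n : ℤ) (q : Pol) : opF n q = X (Sum.inl n) * q := rfl

lemma opH_apply (n : ℤ) (q : Pol) : opH n q = boson n q - (2 : ℂ) • shift n q := rfl

lemma opE_apply (n : ℤ) (q : Pol) :
    opE n q = (Finsupp.lsum ℂ fun k => boson (n + k) - derOp (shift (n + k))) (gradX q) +
      (n : ℂ) • partialX (Sum.inl (-n)) q := rfl

lemma lie_apply (S T : EndPol) (q : Pol) : ⁅S, T⁆ q = S (T q) - T (S q) := rfl

lemma smul_lie_end (c : ℂ) (S T : EndPol) : ⁅c • S, T⁆ = c • ⁅S, T⁆ :=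
  LinearMap.ext fun q => by
    simp only [lie_apply, LinearMap.smul_apply, map_smul, smul_sub]

lemma lie_smul_end (c : ℂ) (S T : EndPol) : ⁅S, c • T⁆ = c • ⁅S, T⁆ :=
  LinearMap.ext fun q => by
    simp only [lie_apply, LinearMap.smul_apply, map_smul, smul_sub]

lemma lie_mulLeft (a b : Pol) : ⁅mulLeft a, mulLeft b⁆ = 0 := by
  refine LinearMap.ext fun q => ?_
  simp only [lie_apply, LinearMap.mulLeft_apply, LinearMap.zero_apply]
  ring

lemma lie_derivation_mulLeft (δ : Derivation ℂ Pol Pol) (a : Pol) :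
    ⁅derOp δ, mulLeft a⁆ = mulLeft (δ a) := by
  refine LinearMap.ext fun q => ?_
  simp only [lie_apply, LinearMap.mulLeft_apply, Derivation.coeFn_coe, Derivation.leibniz,
    smul_eq_mul]
  ring

lemma lie_mulLeft_derivation (δ : Derivation ℂ Pol Pol) (a : Pol) :
    ⁅mulLeft a, derOp δ⁆ = -mulLeft (δ a) := by
  rw [← lie_skew, lie_derivation_mulLeft]

lemma lie_derivation {δ ε : Derivation ℂ Pol Pol} (h : ∀ i, δ (ε (X i)) = ε (δ (X i))) :
    ⁅derOp δ, derOp ε⁆ = 0 := by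
  have : ⁅δ, ε⁆ = 0 := MvPolynomial.derivation_ext fun i => by
    rw [Derivation.commutator_apply, h, sub_self, Derivation.zero_apply]
  rw [← Derivation.commutator_coe_linear_map, this, Derivation.coe_zero_linearMap]

lemma partialX_X (i j : ℤ ⊕ ℤ) : partialX i (X j) = if j = i then 1 else 0 := by
  simp [partialX, MvPolynomial.pderiv_X, Pi.single_apply]

lemma derivation_ite_one (δ : Derivation ℂ Pol Pol) (p : Prop) [Decidable p] :
    δ (if p then 1 else 0) = 0 := by
  split_ifs <;> simp

lemma lie_boson_opF (n p : ℤ) : ⁅boson n, opF p⁆ = 0 := by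
  rw [boson, opF, add_lie, lie_mulLeft, smul_lie_end, lie_derivation_mulLeft, partialX_X]
  simp

lemma lie_boson (m n : ℤ) :
    ⁅boson m, boson n⁆ = if m + n = 0 then (2 * m : ℂ) • (1 : EndPol) else 0 := by
  have h : ⁅derOp (partialX (Sum.inr (-m))),
      derOp (partialX (Sum.inr (-n)))⁆ = 0 :=
    lie_derivation fun i => by simp only [partialX_X, derivation_ite_one]
  simp only [boson, add_lie, lie_add, smul_lie_end, lie_smul_end, lie_mulLeft,
    lie_derivation_mulLeft, lie_mulLeft_derivation, h, partialX_X, Sum.inr.injEq]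
  have e1 : (n = -m) = (m + n = 0) := propext ⟨fun h => by omega, fun h => by omega⟩
  have e2 : (m = -n) = (m + n = 0) := propext ⟨fun h => by omega, fun h => by omega⟩
  simp only [e1, e2]
  split_ifs with h0
  · obtain rfl : n = -m := by omega
    rw [show mulLeft 1 = (1 : EndPol) from LinearMap.ext fun q => one_mul q]
    push_cast
    module
  · simp

lemma lie_shift_boson (m n : ℤ) : ⁅derOp (shift m), boson n⁆ = 0 := by
  have h : ⁅derOp (shift m), derOp (partialX (Sum.inr (-n)))⁆ = 0 := by
    refine lie_derivation fun i => ?_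
    rcases i with i | i <;> simp [partialX_X, derivation_ite_one]
  rw [boson, lie_add, lie_smul_end, h, lie_derivation_mulLeft, shift_X_inr]
  simp

lemma lie_shift_shift (m n : ℤ) :
    ⁅derOp (shift m), derOp (shift n)⁆ = 0 := by
  refine lie_derivation fun i => ?_
  rcases i with i | i <;> simp [add_right_comm]

lemma lie_opF_opF (m n : ℤ) : ⁅opF m, opF n⁆ = 0 := lie_mulLeft _ _

lemma lie_shift_opF (m n : ℤ) : ⁅derOp (shift m), opF n⁆ = opF (n + m) := by
  rw [opF, lie_derivation_mulLeft, shift_X_inl, opF]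

lemma lie_opH_opF (m n : ℤ) : ⁅opH m, opF n⁆ = (-2 : ℂ) • opF (m + n) := by
  rw [opH, sub_lie, smul_lie_end, lie_boson_opF, lie_shift_opF, add_comm n]
  module

lemma lie_opH_opH (m n : ℤ) :
    ⁅opH m, opH n⁆ = if m + n = 0 then (2 * m : ℂ) • (1 : EndPol) else 0 := by
  have h : ⁅boson m, derOp (shift n)⁆ = 0 := by
    rw [← lie_skew, lie_shift_boson, neg_zero]
  simp only [opH, sub_lie, lie_sub, smul_lie_end, lie_smul_end, lie_boson, lie_shift_boson, h,
    lie_shift_shift, smul_zero, sub_zero]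

lemma lie_opE_opF (m n : ℤ) :
    ⁅opE m, opF n⁆ = opH (m + n) + if m + n = 0 then (m : ℂ) • (1 : EndPol) else 0 := by
  set G : (ℤ →₀ Pol) →ₗ[ℂ] Pol :=
    Finsupp.lsum ℂ fun k => boson (m + k) - derOp (shift (m + k)) with hG
  -- Multiplication by `xₙ` commutes with `G` up to `∑ₖ xₘ₊ₙ₊ₖ ∂/∂xₖ = shift (m + n)`.
  set S := Finsupp.linearCombination Pol fun k => (X (Sum.inl (k + (m + n))) : Pol) with hS
  have h1 : ∀ v : ℤ →₀ Pol, G ((X (Sum.inl n) : Pol) • v) = X (Sum.inl n) * G v - S v := by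
    intro v
    induction v using Finsupp.induction_linear with
    | zero => simp
    | add v w hv hw =>
      rw [smul_add, map_add, map_add, map_add, hv, hw]
      ring
    | single k q =>
      have hb := congr($(lie_boson_opF (m + k) n) q)
      have hs := congr($(lie_shift_opF (m + k) n) q)
      simp only [lie_apply, opF_apply, Derivation.coeFn_coe, LinearMap.zero_apply] at hb hs
      rw [show n + (m + k) = k + (m + n) by ring] at hs
      rw [Finsupp.smul_single, hG, hS, Finsupp.lsum_single, Finsupp.lsum_single,
        Finsupp.linearCombination_single, smul_eq_mul, smul_eq_mul, LinearMap.sub_apply,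
        LinearMap.sub_apply, Derivation.coeFn_coe, mul_sub]
      linear_combination hb - hs
  have h2 : ∀ q : Pol, S (gradX q) = shift (m + n) q := by
    have hd : S.compDer gradX = shift (m + n) := by
      refine MvPolynomial.derivation_ext fun i => ?_
      rcases i with i | i <;> simp [hS]
    exact fun q => congr($hd q)
  refine LinearMap.ext fun q => ?_
  have hp : partialX (Sum.inl (-m)) (X (Sum.inl n) : Pol) = if m + n = 0 then 1 else 0 := by
    rw [partialX_X]
    simp only [Sum.inl.injEq]
    congr 1
    exact propext ⟨fun h => by omega, fun h => by omega⟩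
  rw [lie_apply, opF_apply, opF_apply, opE_apply, opE_apply, Derivation.leibniz,
    Derivation.leibniz, ← hG, map_add, h1, h2, gradX_X_inl, Finsupp.smul_single, hG,
    Finsupp.lsum_single, hp, LinearMap.add_apply, opH_apply, two_smul]
  simp only [LinearMap.sub_apply, Derivation.coeFn_coe, smul_eq_mul, mul_one]
  simp only [MvPolynomial.smul_eq_C_mul]
  split_ifs <;> simp [MvPolynomial.smul_eq_C_mul] <;> ring

/-- An operator that commutes with all `xₙ` and kills the polynomials in the `yₙ` vanishes. -/
lemma eq_zero_of_lie_opF {T : EndPol} (hT : ∀ p, ⁅T, opF p⁆ = 0)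
    (h0 : ∀ r : MvPolynomial ℤ ℂ, T (rename Sum.inr r) = 0) : T = 0 := by
  have hX : ∀ p q, T (X (Sum.inl p) * q) = X (Sum.inl p) * T q := fun p q => by
    have := congr($(hT p) q)
    rwa [lie_apply, LinearMap.zero_apply, sub_eq_zero] at this
  have h1 : ∀ p r : MvPolynomial ℤ ℂ, T (rename Sum.inl p * rename Sum.inr r) = 0 := by
    intro p r
    induction p using MvPolynomial.induction_on with
    | C a => rw [MvPolynomial.rename_C, ← MvPolynomial.smul_eq_C_mul, map_smul, h0, smul_zero]
    | add p q hp hq => rw [map_add, add_mul, map_add, hp, hq, add_zero]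
    | mul_X p i hp =>
      rw [map_mul (rename Sum.inl), MvPolynomial.rename_X, mul_comm _ (X _), mul_assoc, hX, hp,
        mul_zero]
  have hspan : ∀ q : Pol, q ∈ Submodule.span ℂ
      {q : Pol | ∃ p r : MvPolynomial ℤ ℂ, q = rename Sum.inl p * rename Sum.inr r} := by
    intro q
    induction q using MvPolynomial.induction_on with
    | C a => exact Submodule.subset_span ⟨C a, 1, by simp⟩
    | add p q hp hq => exact add_mem hp hq
    | mul_X p i hp =>
      induction hp using Submodule.span_induction with
      | zero => simp
      | add p q _ _ hp hq => rw [add_mul]; exact add_mem hp hq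
      | smul c p _ hp => rw [smul_mul_assoc]; exact Submodule.smul_mem _ _ hp
      | mem q hq =>
        obtain ⟨p, r, rfl⟩ := hq
        rcases i with i | i
        · exact Submodule.subset_span ⟨p * X i, r, by rw [map_mul, MvPolynomial.rename_X]; ring⟩
        · exact Submodule.subset_span ⟨p, r * X i, by rw [map_mul, MvPolynomial.rename_X]; ring⟩
  refine LinearMap.ext fun q => ?_
  rw [LinearMap.zero_apply]
  induction hspan q using Submodule.span_induction with
  | zero => exact map_zero T
  | add p q _ _ hp hq => rw [map_add, hp, hq, add_zero]
  | smul c p _ hp => rw [map_smul, hp, smul_zero]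
  | mem q hq =>
    obtain ⟨p, r, rfl⟩ := hq
    exact h1 p r

lemma lie_smul_one (S : EndPol) (c : ℂ) : ⁅S, c • (1 : EndPol)⁆ = 0 := by
  rw [lie_smul_end, LieRing.of_associative_ring_bracket, mul_one, one_mul, sub_self, smul_zero]

lemma lie_ite_one (S : EndPol) (p : Prop) [Decidable p] (c : ℂ) :
    ⁅S, if p then c • (1 : EndPol) else 0⁆ = 0 := by
  split_ifs
  · exact lie_smul_one S c
  · exact lie_zero S

/-- A derivation that vanishes on the `yₙ` vanishes on the polynomials in the `yₙ`. -/
lemma derivation_rename_inr_eq_zero {M : Type*} [AddCommGroup M] [Module ℂ M] [Module Pol M]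
    [IsScalarTower ℂ Pol M] (δ : Derivation ℂ Pol M) (h : ∀ k, δ (X (Sum.inr k)) = 0)
    (r : MvPolynomial ℤ ℂ) : δ (rename Sum.inr r) = 0 := by
  induction r using MvPolynomial.induction_on with
  | C a =>
    rw [MvPolynomial.rename_C]
    exact Derivation.map_algebraMap δ a
  | add p q hp hq => rw [map_add, map_add, hp, hq, add_zero]
  | mul_X p i hp => rw [map_mul, MvPolynomial.rename_X, Derivation.leibniz, hp, h, smul_zero,
      smul_zero, add_zero]

/-- A derivation that maps the `yₙ` to polynomials in the `yₙ` maps all polynomials in the `yₙ` to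
polynomials in the `yₙ`. -/
lemma derivation_rename_inr_mem (δ : Derivation ℂ Pol Pol)
    (h : ∀ k, δ (X (Sum.inr k)) ∈ (rename (R := ℂ) (Sum.inr : ℤ → ℤ ⊕ ℤ)).range)
    (r : MvPolynomial ℤ ℂ) :
    δ (rename Sum.inr r) ∈ (rename (R := ℂ) (Sum.inr : ℤ → ℤ ⊕ ℤ)).range := by
  induction r using MvPolynomial.induction_on with
  | C a =>
    rw [MvPolynomial.rename_C, ← MvPolynomial.algebraMap_eq, Derivation.map_algebraMap]
    exact zero_mem _
  | add p q hp hq => rw [map_add, map_add]; exact add_mem hp hq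
  | mul_X p i hp =>
    rw [map_mul, MvPolynomial.rename_X, Derivation.leibniz]
    exact add_mem (mul_mem ⟨p, rfl⟩ (h i)) (mul_mem ⟨X i, MvPolynomial.rename_X _ _⟩ hp)

lemma opE_rename_inr (n : ℤ) (r : MvPolynomial ℤ ℂ) : opE n (rename Sum.inr r) = 0 := by
  rw [opE_apply, derivation_rename_inr_eq_zero gradX gradX_X_inr,
    derivation_rename_inr_eq_zero (partialX (Sum.inl (-n))) fun k => by simp [partialX_X]]
  simp

lemma opH_rename_inr (n : ℤ) (r : MvPolynomial ℤ ℂ) :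
    ∃ s : MvPolynomial ℤ ℂ, opH n (rename Sum.inr r) = rename Sum.inr s := by
  obtain ⟨s, hs⟩ := derivation_rename_inr_mem (partialX (Sum.inr (-n)))
    (fun k => by rw [partialX_X]; split_ifs; exacts [one_mem _, zero_mem _]) r
  refine ⟨X n * r + (n : ℂ) • s, ?_⟩
  rw [opH_apply, boson_apply, derivation_rename_inr_eq_zero (shift n) (shift_X_inr n), map_add,
    map_mul, map_smul, MvPolynomial.rename_X, smul_zero, sub_zero, ← hs]
  rfl

lemma opD_rename_inr (r : MvPolynomial ℤ ℂ) :
    ∃ s : MvPolynomial ℤ ℂ, opD (rename Sum.inr r) = rename Sum.inr s := by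
  obtain ⟨s, hs⟩ := derivation_rename_inr_mem opD
    (fun k => ⟨(k : ℂ) • X k, by rw [opD_X_inr]; simp⟩) r
  exact ⟨s, hs.symm⟩

/-- The commutators of `opE` with `opH`, `opE` and `opD` are determined, by `eq_zero_of_lie_opF`, by
their commutators with the `xₙ` and their values on the polynomials in the `yₙ`. -/
lemma lie_opH_opE (m n : ℤ) : ⁅opH m, opE n⁆ = (2 : ℂ) • opE (m + n) := by
  rw [← sub_eq_zero]
  refine eq_zero_of_lie_opF (fun p => ?_) fun r => ?_
  · rw [sub_lie, smul_lie_end, lie_lie, lie_opE_opF, lie_opE_opF, lie_opH_opF, lie_add, lie_opH_opH,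
      lie_ite_one, lie_smul_end, lie_opE_opF]
    rw [show n + (m + p) = m + n + p by ring, show m + (n + p) = m + n + p by ring]
    split_ifs
    · push_cast; module
    · module
  · obtain ⟨s, hs⟩ := opH_rename_inr m r
    rw [LinearMap.sub_apply, lie_apply, LinearMap.smul_apply, hs, opE_rename_inr, opE_rename_inr,
      opE_rename_inr]
    simp

lemma lie_opE_opE (m n : ℤ) : ⁅opE m, opE n⁆ = 0 := by
  refine eq_zero_of_lie_opF (fun p => ?_) fun r => ?_
  · rw [lie_lie, lie_opE_opF, lie_opE_opF, lie_add, lie_add, lie_ite_one, lie_ite_one,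
      ← lie_skew (opE m), ← lie_skew (opE n), lie_opH_opE, lie_opH_opE,
      show n + p + m = m + p + n by ring]
    module
  · rw [lie_apply, opE_rename_inr, opE_rename_inr, map_zero, map_zero, sub_zero]

lemma lie_opD_opF (n : ℤ) : ⁅derOp opD, opF n⁆ = (n : ℂ) • opF n := by
  rw [opF, lie_derivation_mulLeft, opD_X_inl]
  refine LinearMap.ext fun q => ?_
  simp

lemma lie_opD_opH (n : ℤ) : ⁅derOp opD, opH n⁆ = (n : ℂ) • opH n := by
  have h1 : ⁅derOp opD, derOp (shift n)⁆ = (n : ℂ) • derOp (shift n) := by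
    have : ⁅opD, shift n⁆ = (n : ℂ) • shift n := MvPolynomial.derivation_ext fun i => by
      rw [Derivation.commutator_apply]
      rcases i with i | i
      · simp
        module
      · simp
    rw [derOp, derOp, ← Derivation.commutator_coe_linear_map, this]
    rfl
  have h2 : ⁅derOp opD, derOp (partialX (Sum.inr (-n)))⁆ =
      (n : ℂ) • derOp (partialX (Sum.inr (-n))) := by
    have : ⁅opD, partialX (Sum.inr (-n))⁆ = (n : ℂ) • partialX (Sum.inr (-n)) :=
      MvPolynomial.derivation_ext fun i => by
        rw [Derivation.commutator_apply]
        rcases i with i | i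
        · simp [partialX_X]
        · by_cases h : i = -n <;> simp [partialX_X, h]
    rw [derOp, derOp, ← Derivation.commutator_coe_linear_map, this]
    rfl
  have h3 : ⁅derOp opD, mulLeft (X (Sum.inr n))⁆ = (n : ℂ) • mulLeft (X (Sum.inr n)) := by
    rw [lie_derivation_mulLeft, opD_X_inr]
    refine LinearMap.ext fun q => ?_
    simp
  rw [opH, boson, lie_sub, lie_add, lie_smul_end, lie_smul_end, h1, h2, h3]
  module

lemma lie_opD_opE (n : ℤ) : ⁅derOp opD, opE n⁆ = (n : ℂ) • opE n := by
  rw [← sub_eq_zero]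
  refine eq_zero_of_lie_opF (fun p => ?_) fun r => ?_
  · rw [sub_lie, smul_lie_end, lie_lie, lie_opE_opF, lie_opD_opF, lie_add, lie_opD_opH,
      lie_ite_one, lie_smul_end, lie_opE_opF]
    split_ifs with h
    · have : (p : ℂ) = -n := by exact_mod_cast (by omega : p = -n)
      push_cast
      rw [this]
      module
    · push_cast
      module
  · obtain ⟨s, hs⟩ := opD_rename_inr r
    rw [LinearMap.sub_apply, lie_apply, LinearMap.smul_apply, Derivation.coeFn_coe, hs,
      opE_rename_inr, opE_rename_inr]
    simp

end Representation

/-! ### Coordinates on the affine Lie algebra -/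

@[elab_as_elim]
lemma loop_induction_T {p : Loop → Prop} (z : Loop) (zero : p 0)
    (tens : ∀ n x, p (tens (LaurentPolynomial.T n) x))
    (add : ∀ x y, p x → p y → p (x + y)) : p z := by
  induction z using loop_induction with
  | zero => exact zero
  | add x y hx hy => exact add x y hx hy
  | tmul f x =>
    induction f using LaurentPolynomial.induction_on' with
    | add f g hf hg => rw [tens_add_left]; exact add _ _ hf hg
    | C_mul_T n a =>
      rw [← LaurentPolynomial.smul_eq_C_mul, tens_smul_left, ← tens_smul_right]
      exact tens n _

/-- The coefficient of `tⁿ` of an element of the loop algebra. -/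
def coef (n : ℤ) : Loop →ₗ[ℂ] Sl2 :=
  Finsupp.lapply n ∘ₗ
    (TensorProduct.equivFinsuppOfBasisLeft (AddMonoidAlgebra.basis ℤ ℂ) :
      ℂ[T;T⁻¹] ⊗[ℂ] Sl2 ≃ₗ[ℂ] ℤ →₀ Sl2).toLinearMap

lemma coef_tens_T (m n : ℤ) (x : Sl2) :
    coef n (tens (LaurentPolynomial.T m) x) = if m = n then x else 0 := by
  have h : coef n (tens (LaurentPolynomial.T m) x) =
      (AddMonoidAlgebra.basis ℤ ℂ).repr (LaurentPolynomial.T m) n • x :=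
    TensorProduct.equivFinsuppOfBasisLeft_apply_tmul_apply ..
  rw [h, ← basis_apply, Module.Basis.repr_self, Finsupp.single_apply, ite_smul, one_smul, zero_smul]

lemma loop_eq_zero {z : Loop} (h : ∀ n, coef n z = 0) : z = 0 := by
  have : (TensorProduct.equivFinsuppOfBasisLeft (AddMonoidAlgebra.basis ℤ ℂ) :
      ℂ[T;T⁻¹] ⊗[ℂ] Sl2 ≃ₗ[ℂ] ℤ →₀ Sl2) z = 0 := Finsupp.ext h
  exact (LinearEquiv.map_eq_zero_iff _).1 this

lemma sl2_apply_one_one (x : Sl2) : x.val 1 1 = -x.val 0 0 := by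
  have h : Matrix.trace x.val = 0 := x.property
  rw [Matrix.trace_fin_two] at h
  linear_combination h

lemma sl2_add_apply (x y : Sl2) (i j : Fin 2) : (x + y).val i j = x.val i j + y.val i j := rfl

lemma sl2_smul_apply (r : ℂ) (x : Sl2) (i j : Fin 2) : (r • x).val i j = r * x.val i j := rfl

lemma sl2_ext {x y : Sl2} (h00 : x.val 0 0 = y.val 0 0) (h01 : x.val 0 1 = y.val 0 1)
    (h10 : x.val 1 0 = y.val 1 0) : x = y := by
  apply Subtype.ext
  ext i j
  fin_cases i <;> fin_cases j
  · exact h00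
  · exact h01
  · exact h10
  · change x.val 1 1 = y.val 1 1
    rw [sl2_apply_one_one, sl2_apply_one_one, h00]

lemma sl2_eq_smul_add (x : Sl2) :
    x = x.val 0 1 • eElt + x.val 1 0 • fElt + x.val 0 0 • hElt := by
  have hx := sl2_apply_one_one x
  apply Subtype.ext
  change x.val = x.val 0 1 • Matrix.single 0 1 1 + x.val 1 0 • Matrix.single 1 0 1 +
    x.val 0 0 • (Matrix.single 0 0 1 - Matrix.single 1 1 1)
  ext i j
  fin_cases i <;> fin_cases j <;> simp [hx]

lemma form_eq (x y : Sl2) :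
    form x y = 2 * (x.val 0 0 * y.val 0 0) + x.val 0 1 * y.val 1 0 + x.val 1 0 * y.val 0 1 := by
  rw [form_apply, Matrix.trace_fin_two, Matrix.mul_apply, Matrix.mul_apply, Fin.sum_univ_two,
    Fin.sum_univ_two, sl2_apply_one_one x, sl2_apply_one_one y]
  ring

lemma lie_val_apply (x y : Sl2) (i j : Fin 2) : ⁅x, y⁆.val i j =
    x.val i 0 * y.val 0 j + x.val i 1 * y.val 1 j -
      (y.val i 0 * x.val 0 j + y.val i 1 * x.val 1 j) := by
  change (x.val * y.val - y.val * x.val) i j = _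
  rw [Matrix.sub_apply, Matrix.mul_apply, Matrix.mul_apply, Fin.sum_univ_two, Fin.sum_univ_two]

/-! ### Faithfulness of the representation -/

section Representation

attribute [local instance] LieRing.ofAssociativeRing

open MvPolynomial (X C)

/-- The linear map on Laurent polynomials with prescribed values at the monomials `tⁿ`. -/
def laurentLift (g : ℤ → EndPol) : ℂ[T;T⁻¹] →ₗ[ℂ] EndPol :=
  (AddMonoidAlgebra.basis ℤ ℂ).constr ℂ g

lemma laurentLift_T (g : ℤ → EndPol) (n : ℤ) : laurentLift g (LaurentPolynomial.T n) = g n := by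
  rw [laurentLift, ← basis_apply, Module.Basis.constr_basis]

/-- The action of the loop algebra on `ℂ[xₙ, yₙ]`. -/
def loopRep : Loop →ₗ[ℂ] EndPol :=
  (TensorProduct.lift (LinearMap.mk₂ ℂ
    (fun f (x : Sl2) => x.val 0 1 • laurentLift opE f + x.val 1 0 • laurentLift opF f +
      x.val 0 0 • laurentLift opH f)
    (by intros; simp only [map_add, smul_add]; abel)
    (by intros; simp only [map_smul]; module)
    (by
      intro f x y
      simp only [sl2_add_apply, add_smul]
      abel)
    (by
      intro c f x
      simp only [sl2_smul_apply, mul_smul, smul_add])) :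
    ℂ[T;T⁻¹] ⊗[ℂ] Sl2 →ₗ[ℂ] EndPol)

lemma loopRep_tens_T (n : ℤ) (x : Sl2) : loopRep (tens (LaurentPolynomial.T n) x) =
    x.val 0 1 • opE n + x.val 1 0 • opF n + x.val 0 0 • opH n := by
  change x.val 0 1 • laurentLift opE _ + x.val 1 0 • laurentLift opF _ +
    x.val 0 0 • laurentLift opH _ = _
  rw [laurentLift_T, laurentLift_T, laurentLift_T]

lemma loopRep_lie (y z : Loop) :
    loopRep ⁅y, z⁆ + cocycle y z • (1 : EndPol) = ⁅loopRep y, loopRep z⁆ := by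
  induction y using loop_induction_T with
  | zero => simp
  | add a b ha hb =>
    simp only [add_lie, map_add, LinearMap.add_apply, add_smul, ← ha, ← hb]
    abel
  | tens m u =>
    induction z using loop_induction_T with
    | zero => simp
    | add a b ha hb =>
      simp only [lie_add, map_add, add_smul, ← ha, ← hb]
      abel
    | tens n v =>
      have hFE : ⁅opF m, opE n⁆ =
          -(opH (m + n) + if m + n = 0 then (n : ℂ) • (1 : EndPol) else 0) := by
        rw [← lie_skew, lie_opE_opF, add_comm n]
      have hEH : ⁅opE m, opH n⁆ = -((2 : ℂ) • opE (m + n)) := by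
        rw [← lie_skew, lie_opH_opE, add_comm n]
      have hFH : ⁅opF m, opH n⁆ = -((-2 : ℂ) • opF (m + n)) := by
        rw [← lie_skew, lie_opH_opF, add_comm n]
      have hmn : (m = -n) = (m + n = 0) := propext ⟨fun h => by omega, fun h => by omega⟩
      rw [tens_lie, ← LaurentPolynomial.T_add, cocycle_T, loopRep_tens_T, loopRep_tens_T,
        loopRep_tens_T, form_eq]
      simp only [lie_val_apply, sl2_apply_one_one, add_lie, lie_add, smul_lie_end, lie_smul_end,
        lie_opE_opF, lie_opE_opE, lie_opF_opF, lie_opH_opF, lie_opH_opE, lie_opH_opH, hFE, hEH,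
        hFH, hmn]
      split_ifs with h
      · have : (n : ℂ) = -m := by exact_mod_cast (by omega : n = -m)
        rw [this]
        module
      · module

lemma lie_opD_loopRep (z : Loop) : ⁅derOp opD, loopRep z⁆ = loopRep (degree z) := by
  induction z using loop_induction_T with
  | zero => simp
  | add a b ha hb => simp only [lie_add, map_add, ha, hb]
  | tens n u =>
    rw [degree_tens, euler_T, tens_smul_left, map_smul, loopRep_tens_T]
    simp only [lie_add, lie_smul_end, lie_opD_opE, lie_opD_opF, lie_opD_opH]
    module

/-- The representation of the affine Lie algebra on `ℂ[xₙ, yₙ]`, of level one. -/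
def hatRep : Hat →ₗ⁅ℂ⁆ EndPol where
  toFun x := loopRep x.loop + x.cen • (1 : EndPol) + x.der • derOp opD
  map_add' x y := by
    simp only [Hat.loop_add, Hat.cen_add, Hat.der_add, map_add, add_smul]
    abel
  map_smul' r x := by
    simp only [Hat.loop_smul, Hat.cen_smul, Hat.der_smul, map_smul, mul_smul, smul_add,
      RingHom.id_apply]
  map_lie' {x y} := by
    have h1 : ∀ S : EndPol, ⁅(1 : EndPol), S⁆ = 0 := fun S => by
      rw [LieRing.of_associative_ring_bracket, mul_one, one_mul, sub_self]
    have h2 : ∀ S : EndPol, ⁅S, (1 : EndPol)⁆ = 0 := fun S => by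
      rw [LieRing.of_associative_ring_bracket, mul_one, one_mul, sub_self]
    simp only [Hat.loop_lie, Hat.cen_lie, Hat.der_lie, map_add, map_sub, map_smul, add_lie, lie_add,
      smul_lie_end, lie_smul_end, h1, h2, lie_self, ← loopRep_lie, lie_opD_loopRep,
      ← lie_skew (loopRep x.loop) (derOp opD)]
    module

lemma hatRep_apply (x : Hat) (q : Pol) :
    hatRep x q = loopRep x.loop q + x.cen • q + x.der • opD q := rfl

lemma opF_one (n : ℤ) : opF n 1 = X (Sum.inl n) := mul_one _

lemma opH_one (n : ℤ) : opH n 1 = X (Sum.inr n) := by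
  rw [opH_apply, boson_apply, Derivation.map_one_eq_zero, Derivation.map_one_eq_zero]
  simp

lemma opE_one (n : ℤ) : opE n 1 = 0 := by
  simpa using opE_rename_inr n 1

lemma opE_X_inl (n p : ℤ) : opE n (X (Sum.inl p)) =
    X (Sum.inr (n + p)) + if n + p = 0 then (n : ℂ) • 1 else 0 := by
  have h := congr($(lie_opE_opF n p) 1)
  rw [lie_apply, opE_one, map_zero, sub_zero, opF_one, LinearMap.add_apply, opH_one] at h
  rw [h]
  split_ifs <;> simp

lemma opH_X_inl (n p : ℤ) : opH n (X (Sum.inl p)) =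
    X (Sum.inr n) * X (Sum.inl p) - (2 : ℂ) • X (Sum.inl (p + n)) := by
  rw [opH_apply, boson_apply, shift_X_inl, partialX_X]
  simp

lemma coeff_X_inl_loopRep_one (n : ℤ) (z : Loop) :
    (loopRep z 1).coeff (Finsupp.single (Sum.inl n) 1) = (coef n z).val 1 0 := by
  induction z using loop_induction_T with
  | zero => simp
  | add a b ha hb => simp [ha, hb]
  | tens m u =>
    rw [loopRep_tens_T, coef_tens_T]
    simp only [LinearMap.add_apply, LinearMap.smul_apply, opE_one, opF_one, opH_one]
    simp [MvPolynomial.coeff_X, Finsupp.single_left_inj]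
    split_ifs <;> simp

lemma coeff_X_inr_loopRep_one (n : ℤ) (z : Loop) :
    (loopRep z 1).coeff (Finsupp.single (Sum.inr n) 1) = (coef n z).val 0 0 := by
  induction z using loop_induction_T with
  | zero => simp
  | add a b ha hb => simp [ha, hb]
  | tens m u =>
    rw [loopRep_tens_T, coef_tens_T]
    simp only [LinearMap.add_apply, LinearMap.smul_apply, opE_one, opF_one, opH_one]
    simp [MvPolynomial.coeff_X, Finsupp.single_left_inj]
    split_ifs <;> simp

lemma coeff_zero_loopRep_one (z : Loop) : (loopRep z 1).coeff 0 = 0 := by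
  induction z using loop_induction_T with
  | zero => simp
  | add a b ha hb => simp [ha, hb]
  | tens m u =>
    rw [loopRep_tens_T]
    simp only [LinearMap.add_apply, LinearMap.smul_apply, opE_one, opF_one, opH_one]
    simp

lemma coeff_single_one (i : ℤ ⊕ ℤ) : (1 : Pol).coeff (Finsupp.single i 1) = 0 := by
  rw [MvPolynomial.coeff_one, if_neg]
  exact fun h => one_ne_zero (Finsupp.single_eq_zero.1 h.symm)

lemma coeff_X_inr_loopRep_X (n : ℤ) (z : Loop) :
    (loopRep z (X (Sum.inl 1))).coeff (Finsupp.single (Sum.inr (n + 1)) 1) =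
      (coef n z).val 0 1 := by
  induction z using loop_induction_T with
  | zero => simp
  | add a b ha hb => simp [ha, hb]
  | tens m u =>
    rw [loopRep_tens_T, coef_tens_T]
    simp only [LinearMap.add_apply, LinearMap.smul_apply, opE_X_inl, opF_apply, opH_X_inl]
    have hmul : (X (Sum.inr m) * X (Sum.inl 1) : Pol).coeff (Finsupp.single (Sum.inr (n + 1)) 1) =
        0 := by
      rw [MvPolynomial.coeff_mul_X', if_neg (by simp)]
    have hmul' : (X (Sum.inl m) * X (Sum.inl 1) : Pol).coeff (Finsupp.single (Sum.inr (n + 1)) 1) =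
        0 := by
      rw [MvPolynomial.coeff_mul_X', if_neg (by simp)]
    have hE : (X (Sum.inr (m + 1)) + if m + 1 = 0 then (m : ℂ) • 1 else 0 : Pol).coeff
        (Finsupp.single (Sum.inr (n + 1)) 1) = if m = n then 1 else 0 := by
      rw [MvPolynomial.coeff_add, MvPolynomial.coeff_X]
      split_ifs <;> simp_all [coeff_single_one, Finsupp.single_left_inj]
    simp only [MvPolynomial.coeff_add, MvPolynomial.coeff_sub, MvPolynomial.coeff_smul, hmul, hmul',
      MvPolynomial.coeff_X, Finsupp.single_left_inj one_ne_zero, reduceCtorEq, if_false] at hE ⊢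
    rw [hE]
    split_ifs <;> simp

/-- The representation `hatRep` is faithful: an element is recovered from its action on `1` and on
`x₁`. -/
theorem hatRep_injective {x : Hat} (hx : hatRep x = 0) : x = 0 := by
  have h0 : ∀ q, loopRep x.loop q + x.cen • q + x.der • opD q = 0 := fun q => by
    rw [← hatRep_apply, hx, LinearMap.zero_apply]
  have h1 : loopRep x.loop 1 + x.cen • 1 = 0 := by
    simpa using h0 1
  have h2 : loopRep x.loop (X (Sum.inl 1)) + (x.cen + x.der) • X (Sum.inl 1) = 0 := by
    have := h0 (X (Sum.inl 1))
    rw [opD_X_inl] at this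
    rw [← this]
    push_cast
    module
  have hc : x.cen = 0 := by
    have := congrArg (MvPolynomial.coeff 0) h1
    simpa [coeff_zero_loopRep_one] using this
  have hl : x.loop = 0 := by
    refine loop_eq_zero fun n => sl2_ext ?_ ?_ ?_
    · have := congrArg (MvPolynomial.coeff (Finsupp.single (Sum.inr n) 1)) h1
      simpa [coeff_X_inr_loopRep_one, coeff_single_one] using this
    · have := congrArg (MvPolynomial.coeff (Finsupp.single (Sum.inr (n + 1)) 1)) h2
      simpa [coeff_X_inr_loopRep_X, MvPolynomial.coeff_X, Finsupp.single_left_inj] using this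
    · have := congrArg (MvPolynomial.coeff (Finsupp.single (Sum.inl n) 1)) h1
      simpa [coeff_X_inl_loopRep_one, coeff_single_one] using this
  have hd : x.der = 0 := by
    rw [hl, hc] at h2
    simpa using h2
  exact Hat.ext hl hc hd

/-- The affine Lie algebra embeds into its enveloping algebra, with image independent of `1`. -/
theorem eq_zero_of_algebraMap_add_ι_hat {r : ℂ} {x : Hat}
    (h : algebraMap ℂ UHat r + UniversalEnvelopingAlgebra.ι ℂ x = 0) : r = 0 ∧ x = 0 := by
  have hr := eq_zero_of_algebraMap_add_ι_eq_zero h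
  refine ⟨hr, hatRep_injective ?_⟩
  rw [hr, map_zero, zero_add] at h
  rw [← UniversalEnvelopingAlgebra.lift_ι_apply ℂ hatRep x, h, map_zero]

end Representation

/-! ### The decomposition of the affine Lie algebra at a regular point -/

lemma rootValue_neg (a : Torus) (α : RootLattice) : rootValue a (-α) = (rootValue a α)⁻¹ := by
  rw [eq_inv_iff_mul_eq_one, ← rootValue_add, neg_add_cancel, rootValue_zero]

lemma rootValue_inv (a : Torus) (α : RootLattice) : rootValue a⁻¹ α = (rootValue a α)⁻¹ := by
  rw [rootValue, rootValue, mul_inv, ← inv_zpow, ← inv_zpow, mul_inv]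
  rfl

lemma neg_mem_roots {α : RootLattice} (h : α ∈ roots) : -α ∈ roots := by
  rcases h with h | h
  · exact Or.inr (by rwa [negRoots, Set.mem_ofPred_eq, neg_neg])
  · exact Or.inl h

lemma zsmul_delta_add_alpha1_mem (n : ℤ) : n • delta + alpha1 ∈ roots := by
  rcases lt_trichotomy n 0 with h | rfl | h
  · refine Or.inr (Or.inr ⟨n.natAbs, by omega, -alpha1, by simp, ?_⟩)
    have : (n.natAbs : ℤ) = -n := by omega
    rw [← natCast_zsmul, this]
    module
  · exact Or.inl (Or.inl (by simp))
  · refine Or.inl (Or.inr ⟨n.natAbs, by omega, alpha1, by simp, ?_⟩)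
    have : (n.natAbs : ℤ) = n := by omega
    rw [← natCast_zsmul, this]

lemma zsmul_delta_sub_alpha1_mem (n : ℤ) : n • delta + -alpha1 ∈ roots := by
  have := neg_mem_roots (zsmul_delta_add_alpha1_mem (-n))
  rwa [neg_add, neg_smul, neg_neg] at this

lemma zsmul_delta_mem {n : ℤ} (hn : n ≠ 0) : n • delta ∈ roots := by
  rcases lt_or_gt_of_ne hn with h | h
  · refine Or.inr (Or.inr ⟨n.natAbs, by omega, 0, by simp, ?_⟩)
    have : (n.natAbs : ℤ) = -n := by omega
    rw [← natCast_zsmul, this]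
    module
  · refine Or.inl (Or.inr ⟨n.natAbs, by omega, 0, by simp, ?_⟩)
    have : (n.natAbs : ℤ) = n := by omega
    rw [← natCast_zsmul, this, add_zero]

lemma coef_loopMap_scale (u q : ℂˣ) (n : ℤ) (z : Loop) :
    coef n (loopMap (scaleT u) (scaleSl2 q) z) = ((u ^ n : ℂˣ) : ℂ) • scaleSl2 q (coef n z) := by
  induction z using loop_induction_T with
  | zero => simp
  | add a b ha hb => simp only [map_add, ha, hb, smul_add]
  | tens m x =>
    rw [loopMap_tens, scaleT_T, tens_smul_left, map_smul, coef_tens_T, coef_tens_T]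
    split_ifs with h
    · rw [h]
    · simp

lemma coef_loopMap_theta (n : ℤ) (z : Loop) :
    coef n (loopMap invertT theta z) = theta (coef (-n) z) := by
  induction z using loop_induction_T with
  | zero => simp
  | add a b ha hb => simp only [map_add, ha, hb]
  | tens m x =>
    rw [loopMap_tens, invertT_T, coef_tens_T, coef_tens_T]
    have : (-m = n) = (m = -n) := propext ⟨fun h => by omega, fun h => by omega⟩
    simp only [this]
    split_ifs <;> simp

lemma coef_Ad_01 (a : Torus) (n : ℤ) (x : Hat) : (coef n (Ad a x).loop).val 0 1 =
    rootValue a (n • delta + alpha1) * (coef n x.loop).val 0 1 := by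
  change (coef n (loopMap (scaleT (rootValue a delta)) (scaleSl2 (rootValue a alpha1)) x.loop)).val
    0 1 = _
  rw [coef_loopMap_scale, sl2_smul_apply, scaleSl2_val, rootValue_add, rootValue_zsmul_delta,
    Units.val_mul, mul_assoc]
  rfl

lemma scaleMat_apply_one_zero (q : ℂˣ) (M : Matrix (Fin 2) (Fin 2) ℂ) :
    scaleMat q M 1 0 = ((q⁻¹ : ℂˣ) : ℂ) * M 1 0 := rfl

lemma coef_Ad_10 (a : Torus) (n : ℤ) (x : Hat) : (coef n (Ad a x).loop).val 1 0 =
    rootValue a (n • delta + -alpha1) * (coef n x.loop).val 1 0 := by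
  change (coef n (loopMap (scaleT (rootValue a delta)) (scaleSl2 (rootValue a alpha1)) x.loop)).val
    1 0 = _
  rw [coef_loopMap_scale, sl2_smul_apply, scaleSl2_val, rootValue_add, rootValue_zsmul_delta,
    rootValue_neg, Units.val_mul, mul_assoc, scaleMat_apply_one_zero]

lemma coef_Ad_00 (a : Torus) (n : ℤ) (x : Hat) : (coef n (Ad a x).loop).val 0 0 =
    rootValue a (n • delta) * (coef n x.loop).val 0 0 := by
  change (coef n (loopMap (scaleT (rootValue a delta)) (scaleSl2 (rootValue a alpha1)) x.loop)).val
    0 0 = _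
  rw [coef_loopMap_scale, sl2_smul_apply, scaleSl2_val, rootValue_zsmul_delta]
  rfl

lemma coef_fixed {x : Hat} (hx : x ∈ fixedSubalgebra) (n : ℤ) :
    coef n x.loop = theta (coef (-n) x.loop) := by
  have h : x.loop = loopMap invertT theta x.loop :=
    congrArg Hat.loop (show thetaHat x = x from hx).symm
  exact (congrArg (coef n) h).trans (coef_loopMap_theta n x.loop)

lemma coef_fixed_01 {x : Hat} (hx : x ∈ fixedSubalgebra) (n : ℤ) :
    (coef n x.loop).val 0 1 = -(coef (-n) x.loop).val 1 0 :=
  congrArg (fun y : Sl2 => y.val 0 1) (coef_fixed hx n)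

lemma coef_fixed_00 {x : Hat} (hx : x ∈ fixedSubalgebra) (n : ℤ) :
    (coef n x.loop).val 0 0 = -(coef (-n) x.loop).val 0 0 :=
  congrArg (fun y : Sl2 => y.val 0 0) (coef_fixed hx n)

lemma cen_fixed {x : Hat} (hx : x ∈ fixedSubalgebra) : x.cen = 0 := by
  have h : -x.cen = x.cen := congrArg Hat.cen (show thetaHat x = x from hx)
  linear_combination -h / 2

lemma der_fixed {x : Hat} (hx : x ∈ fixedSubalgebra) : x.der = 0 := by
  have h : -x.der = x.der := congrArg Hat.der (show thetaHat x = x from hx)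
  linear_combination -h / 2

/-- An element of the fixed subalgebra is determined by its `e`-coordinates and by its
`h`-coordinates of nonzero degree. -/
lemma fixed_eq_zero {x : Hat} (hx : x ∈ fixedSubalgebra)
    (h01 : ∀ n, (coef n x.loop).val 0 1 = 0) (h00 : ∀ n ≠ 0, (coef n x.loop).val 0 0 = 0) :
    x = 0 := by
  refine Hat.ext (loop_eq_zero fun n => sl2_ext ?_ (h01 n) ?_) (cen_fixed hx) (der_fixed hx)
  · by_cases hn : n = 0
    · subst hn
      have h := coef_fixed_00 hx 0
      rw [neg_zero] at h
      change _ = (0 : ℂ)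
      linear_combination h / 2
    · exact h00 n hn
  · have h := coef_fixed_01 hx (-n)
    rw [h01, neg_neg] at h
    change _ = (0 : ℂ)
    linear_combination h

lemma coef_cartan {x : Hat} (hx : x ∈ cartan) (n : ℤ) :
    (coef n x.loop).val 0 1 = 0 ∧ (coef n x.loop).val 1 0 = 0 ∧
      (n ≠ 0 → (coef n x.loop).val 0 0 = 0) := by
  have hx' : x ∈ Submodule.span ℂ {Hat.h0, Hat.h1, Hat.d} := hx
  have h1 : (coef n (tens 1 hElt)).val 0 1 = 0 ∧ (coef n (tens 1 hElt)).val 1 0 = 0 ∧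
      (n ≠ 0 → (coef n (tens 1 hElt)).val 0 0 = 0) := by
    rw [← LaurentPolynomial.T_zero, coef_tens_T]
    split_ifs with h
    · have e1 : hElt.val 0 1 = 0 := by
        change (Matrix.single 0 0 1 - Matrix.single 1 1 1 : Matrix (Fin 2) (Fin 2) ℂ) 0 1 = 0
        simp
      have e2 : hElt.val 1 0 = 0 := by
        change (Matrix.single 0 0 1 - Matrix.single 1 1 1 : Matrix (Fin 2) (Fin 2) ℂ) 1 0 = 0
        simp
      exact ⟨e1, e2, fun h' => absurd h.symm h'⟩
    · exact ⟨rfl, rfl, fun _ => rfl⟩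
  have neg_apply : ∀ (y : Sl2) (i j : Fin 2), (-y).val i j = -y.val i j := fun _ _ _ => rfl
  clear hx
  induction hx' using Submodule.span_induction with
  | zero => simp
  | add y z _ _ hy hz =>
    simp only [Hat.loop_add, map_add, sl2_add_apply, hy.1, hy.2.1, hz.1, hz.2.1, add_zero, true_and]
    intro hn
    rw [hy.2.2 hn, hz.2.2 hn, add_zero]
  | smul r y _ hy =>
    simp only [Hat.loop_smul, map_smul, sl2_smul_apply, hy.1, hy.2.1, mul_zero, true_and]
    intro hn
    rw [hy.2.2 hn, mul_zero]
  | mem y hy =>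
    rcases hy with rfl | rfl | rfl
    · simp only [Hat.h0, map_neg, neg_apply, h1.1, h1.2.1, neg_zero, true_and]
      intro hn
      rw [h1.2.2 hn, neg_zero]
    · exact h1
    · simp [Hat.d]

lemma eq_zero_of_mul_add_eq_zero {r : ℂˣ} (hr : r ^ 2 ≠ 1) {X Y : ℂ} (h1 : r * X + Y = 0)
    (h2 : ((r⁻¹ : ℂˣ) : ℂ) * X + Y = 0) : X = 0 ∧ Y = 0 := by
  have hX : ((r : ℂ) ^ 2 - 1) * X = 0 := by
    have h3 : (r : ℂ) * ((r⁻¹ : ℂˣ) : ℂ) = 1 := by simp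
    linear_combination (r : ℂ) * h1 - r * h2 + X * h3
  have hr' : (r : ℂ) ^ 2 - 1 ≠ 0 := by
    rw [sub_ne_zero]
    exact fun h => hr (Units.ext (by simpa using h))
  obtain rfl : X = 0 := (mul_eq_zero.1 hX).resolve_left hr'
  exact ⟨rfl, by simpa using h1⟩

/-- At a regular point `a` the sum `𝔨ᵃ + 𝔥 + 𝔨` is direct: the root vectors of roots `α` and `-α`
occur in `𝔨ᵃ` and in `𝔨` with the ratios `α(a)⁻² : -1` and `1 : -1`. -/
theorem eq_zero_of_Ad_add_add_eq_zero {a : Torus} (ha : a ∈ regular) {x h y : Hat}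
    (hx : x ∈ fixedSubalgebra) (hh : h ∈ cartan) (hy : y ∈ fixedSubalgebra)
    (h0 : Ad a⁻¹ x + h + y = 0) : x = 0 ∧ h = 0 ∧ y = 0 := by
  have hreg : ∀ α ∈ roots, rootValue a⁻¹ α ^ 2 ≠ 1 := by
    intro α hα h
    rw [rootValue_inv, inv_pow, inv_eq_one] at h
    exact ha α hα h
  have hcoef : ∀ n i j, (coef n (Ad a⁻¹ x).loop).val i j + (coef n h.loop).val i j +
      (coef n y.loop).val i j = 0 := fun n i j => by
    have := congrArg (fun z : Hat => (coef n z.loop).val i j) h0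
    simp only [Hat.loop_add, map_add, sl2_add_apply, Hat.loop_zero, map_zero] at this
    exact this
  have h01 : ∀ n, (coef n x.loop).val 0 1 = 0 ∧ (coef n y.loop).val 0 1 = 0 := by
    intro n
    have e1 := hcoef n 0 1
    have e2 := hcoef (-n) 1 0
    rw [coef_Ad_01, (coef_cartan hh n).1, add_zero] at e1
    rw [coef_Ad_10, (coef_cartan hh (-n)).2.1, add_zero, neg_smul, ← neg_add, rootValue_neg] at e2
    rw [coef_fixed_01 hx n, coef_fixed_01 hy n] at e1 ⊢
    refine eq_zero_of_mul_add_eq_zero (hreg _ (zsmul_delta_add_alpha1_mem n)) e1 ?_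
    linear_combination -e2
  have h00 : ∀ n ≠ 0, (coef n x.loop).val 0 0 = 0 ∧ (coef n y.loop).val 0 0 = 0 := by
    intro n hn
    have e1 := hcoef n 0 0
    have e2 := hcoef (-n) 0 0
    rw [coef_Ad_00, (coef_cartan hh n).2.2 hn, add_zero] at e1
    rw [coef_Ad_00, (coef_cartan hh (-n)).2.2 (neg_ne_zero.2 hn), add_zero, neg_smul,
      rootValue_neg] at e2
    rw [coef_fixed_00 hx n, coef_fixed_00 hy n] at e1 ⊢
    refine eq_zero_of_mul_add_eq_zero (hreg _ (zsmul_delta_mem hn)) e1 ?_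
    linear_combination -e2
  have x0 : x = 0 := fixed_eq_zero hx (fun n => (h01 n).1) fun n hn => (h00 n hn).1
  have y0 : y = 0 := fixed_eq_zero hy (fun n => (h01 n).2) fun n hn => (h00 n hn).2
  refine ⟨x0, ?_, y0⟩
  simpa [x0, y0] using h0

/-! ### Injectivity at a regular point -/

lemma conjBy_ι (a : Torus) (x : Hat) :
    conjBy a (UniversalEnvelopingAlgebra.ι ℂ x) = UniversalEnvelopingAlgebra.ι ℂ (Ad a⁻¹ x) :=
  envMap_ι _ _

/-- The map `H ⊗ X ⊗ Y ↦ Xᵃ H Y` is injective at a regular point `a`. -/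
theorem gammaBase_injective {a : Torus} (ha : a ∈ regular) :
    Function.Injective (gammaBase a) := by
  have hP := (primitivelyGenerated_enveloping (K := ℂ) (L := cartan)).tensor
    (primitivelyGenerated_enveloping (K := ℂ) (L := fixedSubalgebra))
  have hB := hP.tensor (primitivelyGenerated_enveloping (K := ℂ) (L := fixedSubalgebra))
  have hincl : ∀ X : UFixed, comul (envMap fixedSubalgebra.incl X) = TensorProduct.map
      (envMap fixedSubalgebra.incl).toLinearMap (envMap fixedSubalgebra.incl).toLinearMap
        (comul X) :=
    comul_algHom (envMap fixedSubalgebra.incl) fun x => ⟨x, envMap_ι _ _⟩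
  have hcart := comul_algHom (envMap cartan.incl) fun x => ⟨x, envMap_ι _ _⟩
  have hconj := comul_algHom ((conjBy a).comp (envMap fixedSubalgebra.incl)) fun x =>
    ⟨Ad a⁻¹ x, by rw [AlgHom.comp_apply, envMap_ι]; exact conjBy_ι a x⟩
  let m : UCartan ⊗[ℂ] UFixed →ₗ[ℂ] UHat := TensorProduct.lift
    ((LinearMap.mul ℂ UHat).flip.compl₁₂ (envMap cartan.incl).toLinearMap
      ((conjBy a).toLinearMap ∘ₗ (envMap fixedSubalgebra.incl).toLinearMap))
  have hm := comul_mul_eq_map (m := m) hcart hconj (Or.inr fun _ _ => rfl)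
  have hf := comul_mul_eq_map (m := gammaBase a) hm hincl
    (Or.inl fun u v => by induction u using TensorProduct.induction_on <;> rfl)
  refine hB.injective (ΔD := comul.toLinearMap) hf ?_
  intro r z hz h0
  obtain ⟨_, ⟨_, hw, rfl⟩, _, ⟨_, ⟨y, rfl⟩, rfl⟩, rfl⟩ := Submodule.mem_sup.1 hz
  obtain ⟨_, ⟨_, ⟨h, rfl⟩, rfl⟩, _, ⟨_, ⟨x, rfl⟩, rfl⟩, rfl⟩ := Submodule.mem_sup.1 hw
  have hval : gammaBase a (algebraMap ℂ _ r +
      ((UniversalEnvelopingAlgebra.ι ℂ h ⊗ₜ 1 + 1 ⊗ₜ UniversalEnvelopingAlgebra.ι ℂ x) ⊗ₜ 1 +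
        1 ⊗ₜ UniversalEnvelopingAlgebra.ι ℂ y)) =
      algebraMap ℂ UHat r + UniversalEnvelopingAlgebra.ι ℂ (Ad a⁻¹ x + h + y) := by
    rw [Algebra.algebraMap_eq_smul_one, Algebra.TensorProduct.one_def,
      Algebra.TensorProduct.one_def, TensorProduct.add_tmul]
    simp only [map_add, map_smul, gammaBase_tmul, map_one, envMap_ι, conjBy_ι, one_mul, mul_one,
      Algebra.algebraMap_eq_smul_one, LieSubalgebra.coe_incl]
    abel
  obtain ⟨rfl, h2⟩ := eq_zero_of_algebraMap_add_ι_hat (hval.symm.trans h0)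
  obtain ⟨hx0, hh0, hy0⟩ := eq_zero_of_Ad_add_add_eq_zero ha x.2 h.2 y.2 h2
  obtain rfl : x = 0 := Subtype.ext hx0
  obtain rfl : h = 0 := Subtype.ext hh0
  obtain rfl : y = 0 := Subtype.ext hy0
  simp

/-! ### Regular points separate the elements of the coefficient ring -/

/-- The point with `α(a) = 4⁻⁽ᵐ⁻ⁿ⁾ 3⁻ᵐ` for `α = m α₀ + n α₁`. -/
def genericPoint : Torus :=
  (Units.mk0 (1 / 2) (by norm_num), 1, Units.mk0 (1 / 3) (by norm_num))

lemma genericPoint_eq_zero {α : RootLattice} (h : rootValue genericPoint α = 1) : α = 0 := by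
  have h' : (2 : ℚ)⁻¹ ^ (2 * (α.1 - α.2)) * (3 : ℚ)⁻¹ ^ α.1 = 1 := by
    have h1 := congrArg Units.val h
    simp only [rootValue, genericPoint, inv_one, mul_one, Units.val_mul, Units.val_zpow_eq_zpow_val,
      Units.val_mk0, Units.val_one, one_div] at h1
    have h2 : (((2 : ℚ)⁻¹ ^ (2 * (α.1 - α.2)) * (3 : ℚ)⁻¹ ^ α.1 : ℚ) : ℂ) = (1 : ℚ) := by
      push_cast
      exact h1
    exact_mod_cast h2
  have : Fact (Nat.Prime 2) := ⟨Nat.prime_two⟩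
  have : Fact (Nat.Prime 3) := ⟨Nat.prime_three⟩
  have e22 : padicValRat 2 2 = 1 := padicValRat.self (p := 2) (by norm_num)
  have e33 : padicValRat 3 3 = 1 := padicValRat.self (p := 3) (by norm_num)
  have e23 : padicValRat 2 3 = 0 := by
    have := padicValRat.of_nat (p := 2) (n := 3)
    rw [padicValNat.eq_zero_of_not_dvd (by norm_num)] at this
    exact_mod_cast this
  have e32 : padicValRat 3 2 = 0 := by
    have := padicValRat.of_nat (p := 3) (n := 2)
    rw [padicValNat.eq_zero_of_not_dvd (by norm_num)] at this
    exact_mod_cast this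
  have v2 := congrArg (padicValRat 2) h'
  have v3 := congrArg (padicValRat 3) h'
  rw [padicValRat.mul (zpow_ne_zero _ (by norm_num)) (zpow_ne_zero _ (by norm_num)),
    padicValRat.zpow, padicValRat.zpow, padicValRat.inv, padicValRat.inv, padicValRat.one] at v2 v3
  rw [e22, e23] at v2
  rw [e32, e33] at v3
  exact Prod.ext (by simp only [Prod.fst_zero]; omega) (by simp only [Prod.snd_zero]; omega)

lemma rootValue_pow (a : Torus) (k : ℕ) (α : RootLattice) :
    rootValue (a ^ k) α = rootValue a α ^ k := by
  induction k with
  | zero => simp [rootValue]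
  | succ k ih =>
    rw [pow_succ, pow_succ, ← ih]
    simp only [rootValue, Prod.fst_mul, Prod.snd_mul, mul_zpow, mul_inv]
    exact (by ac_rfl)

lemma rootValue_nsmul (a : Torus) (k : ℕ) (α : RootLattice) :
    rootValue a (k • α) = rootValue a α ^ k := by
  induction k with
  | zero => rw [zero_smul, rootValue_zero, pow_zero]
  | succ k ih => rw [succ_nsmul, rootValue_add, ih, pow_succ]

lemma zero_notMem_roots : (0 : RootLattice) ∉ roots := by
  have h : (0 : RootLattice) ∉ posRoots := by
    rintro (h | ⟨n, hn, β, hβ, h⟩)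
    · exact absurd (congrArg Prod.snd h) (by simp [alpha1])
    · have h1 := congrArg Prod.fst h
      rcases hβ with rfl | rfl | rfl <;> simp [delta, alpha1] at h1 <;> omega
  rintro (h' | h')
  · exact h h'
  · exact h (by simpa [negRoots] using h')

lemma genericPoint_pow_mem (k : ℕ) : genericPoint ^ (k + 1) ∈ regular := by
  intro α hα h
  rw [rootValue_pow, ← pow_mul, ← rootValue_nsmul] at h
  have h0 := (smul_eq_zero.1 (genericPoint_eq_zero h)).resolve_left (by omega)
  exact zero_notMem_roots (h0 ▸ hα)

/-- An element of `ℂ[Q]` that vanishes at all regular points is zero: it vanishes at all powers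
`aᵏ`, `k ≥ 1`, of a point `a` with distinct values `α(a)`, and distinct characters of `ℕ` are
linearly independent. -/
lemma eq_zero_of_evalQ {p : AddMonoidAlgebra ℂ RootLattice}
    (hp : ∀ a ∈ regular, evalQ a p = 0) : p = 0 := by
  let χ : RootLattice → Multiplicative ℕ →* ℂ := fun α =>
    powersHom ℂ (rootValue genericPoint α : ℂ)
  have hχ : Function.Injective χ := by
    intro α β h
    have h1 : (rootValue genericPoint α : ℂ) = rootValue genericPoint β := (powersHom ℂ).injective h
    have h2 : rootValue genericPoint (α - β) = 1 := by
      rw [sub_eq_add_neg, rootValue_add, rootValue_neg, Units.ext h1, mul_inv_cancel]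
    exact sub_eq_zero.1 (genericPoint_eq_zero h2)
  have hli := ((linearIndependent_monoidHom (Multiplicative ℕ) ℂ).comp χ hχ).units_smul
    (rootValue genericPoint)
  have h0 := linearIndependent_iff.1 hli p.coeff ?_
  · exact AddMonoidAlgebra.coeff_injective h0
  · funext k
    have hk := hp _ (genericPoint_pow_mem k.toAdd)
    rw [evalQ, AddMonoidAlgebra.lift_apply] at hk
    rw [Finsupp.linearCombination_apply, Finsupp.sum_apply', Pi.zero_apply, ← hk]
    refine Finsupp.sum_congr fun α _ => ?_
    change p.coeff α • ((rootValue genericPoint α : ℂ) * (rootValue genericPoint α : ℂ) ^ k.toAdd) =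
      p.coeff α • ((rootValue (genericPoint ^ (k.toAdd + 1)) α : ℂˣ) : ℂ)
    rw [rootValue_pow, Units.val_pow_eq_pow_val, pow_succ']

lemma eq_zero_of_evalR {f : CoeffRing} (hf : ∀ a (ha : a ∈ regular), evalR a ha f = 0) :
    f = 0 := by
  obtain ⟨⟨p, q⟩, h⟩ := IsLocalization.surj denominators f
  have hp : p = 0 := eq_zero_of_evalQ fun a ha => by
    rw [← evalR_algebraMap a ha, ← h, map_mul, hf, zero_mul]
  rw [hp, map_zero] at h
  exact (IsUnit.mul_left_eq_zero (IsLocalization.map_units CoeffRing q)).1 h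

/-- Elements of `R ⊗ M` are separated by the evaluations at regular points. -/
lemma eq_zero_of_evalR_tensor {M : Type*} [AddCommGroup M] [Module ℂ M] {P : CoeffRing ⊗[ℂ] M}
    (hP : ∀ a (ha : a ∈ regular),
      TensorProduct.lid ℂ M ((evalR a ha).toLinearMap.rTensor M P) = 0) : P = 0 := by
  classical
  let b := Module.Basis.ofVectorSpace ℂ M
  apply (TensorProduct.equivFinsuppOfBasisRight b (M := CoeffRing)).injective
  rw [map_zero]
  ext i
  refine eq_zero_of_evalR fun a ha => ?_
  have key : ∀ P : CoeffRing ⊗[ℂ] M,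
      evalR a ha (TensorProduct.equivFinsuppOfBasisRight b P i) =
        b.coord i (TensorProduct.lid ℂ M ((evalR a ha).toLinearMap.rTensor M P)) := by
    intro P
    induction P using TensorProduct.induction_on with
    | zero => simp
    | add x y hx hy => simp only [map_add, Finsupp.add_apply, hx, hy]
    | tmul f m =>
      rw [TensorProduct.equivFinsuppOfBasisRight_apply_tmul_apply]
      simp [mul_comm]
  rw [key, hP a ha, map_zero]

lemma gamma_eq (a : Torus) (ha : a ∈ regular)
    (P : CoeffRing ⊗[ℂ] (UCartan ⊗[ℂ] UFixed ⊗[ℂ] UFixed)) :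
    gamma a ha P = gammaBase a (TensorProduct.lid ℂ _ ((evalR a ha).toLinearMap.rTensor _ P)) := by
  induction P using TensorProduct.induction_on with
  | zero => simp
  | add x y hx hy => simp only [map_add, hx, hy]
  | tmul f Z => rw [gamma_tmul]; simp

/-- The values at all regular points determine an element of the source of `gamma`. -/
theorem eq_of_gamma_eq {P P' : CoeffRing ⊗[ℂ] (UCartan ⊗[ℂ] UFixed ⊗[ℂ] UFixed)}
    (h : ∀ a (ha : a ∈ regular), gamma a ha P = gamma a ha P') : P = P' := by
  rw [← sub_eq_zero]
  refine eq_zero_of_evalR_tensor fun a ha => ?_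
  apply gammaBase_injective ha
  rw [← gamma_eq, map_sub, h, sub_self, map_zero]

open UniversalEnvelopingAlgebra (ι)

/-! ### Families over the regular points -/

/-- The functions from the regular points of the torus to `U(𝔤)`. -/
def Family : Type := regular → UHat

namespace Family

instance : Ring Family := inferInstanceAs (Ring (regular → UHat))

/-- The coefficient ring acts on functions by its evaluations. -/
def scalar : CoeffRing →+* Family where
  toFun f := fun a => algebraMap ℂ UHat (evalR a a.2 f)
  map_one' := by funext a; rw [map_one, map_one]; rfl
  map_mul' f g := by funext a; rw [map_mul, map_mul]; rfl
  map_zero' := by funext a; rw [map_zero, map_zero]; rfl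
  map_add' f g := by funext a; rw [map_add, map_add]; rfl

instance : Algebra CoeffRing Family :=
  scalar.toAlgebra' fun f φ => funext fun a => Algebra.commutes (evalR a a.2 f) (φ a)

lemma sub_apply (φ ψ : Family) (a : regular) : (φ - ψ) a = φ a - ψ a := rfl

lemma smul_apply (f : CoeffRing) (φ : Family) (a : regular) :
    (f • φ) a = evalR a a.2 f • φ a :=
  (Algebra.smul_def (evalR a a.2 f) (φ a)).symm

/-- Constant functions. -/
def const : UHat →+* Family := Pi.constRingHom regular UHat

/-- The function `a ↦ Xᵃ`. -/
def conj : UHat →+* Family := RingHom.pi fun a => (conjBy a : UHat →+* UHat)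

lemma const_apply (X : UHat) (a : regular) : const X a = X := rfl

lemma conj_apply (X : UHat) (a : regular) : conj X a = conjBy a X := rfl

end Family

open Family (const conj)

/-- The function `e^α` as an element of the coefficient ring. -/
def expR (α : RootLattice) : CoeffRing := algebraMap _ CoeffRing (expQ α)

lemma evalR_expR (a : Torus) (ha : a ∈ regular) (α : RootLattice) :
    evalR a ha (expR α) = rootValue a α := by
  rw [expR, evalR_algebraMap, evalQ_expQ]

lemma expR_add (α β : RootLattice) : expR (α + β) = expR α * expR β := by
  rw [expR, expR, expR, ← map_mul, expQ, expQ, expQ, AddMonoidAlgebra.single_mul_single, one_mul]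

lemma expR_zero : expR 0 = 1 := map_one _

lemma isUnit_expR (α : RootLattice) : IsUnit (expR α) :=
  IsUnit.of_mul_eq_one (expR (-α)) (by rw [← expR_add, add_neg_cancel, expR_zero])

lemma isUnit_expR_neg_sub {α : RootLattice} (hα : α ∈ roots) :
    IsUnit (expR (-α) - expR α) := by
  have key : ∀ γ ∈ negRoots, IsUnit (expR (-γ) - expR γ) := by
    intro γ hγ
    have h1 : IsUnit (algebraMap _ CoeffRing (1 - expQ (2 • γ))) :=
      IsLocalization.map_units CoeffRing (⟨_, Submonoid.subset_closure ⟨γ, hγ, rfl⟩⟩ : denominators)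
    have h2 : expR (-γ) - expR γ = expR (-γ) * algebraMap _ CoeffRing (1 - expQ (2 • γ)) := by
      rw [map_sub, map_one, ← expR, mul_sub, mul_one, ← expR_add]
      congr 2
      module
    rw [h2]
    exact (isUnit_expR _).mul h1
  rcases hα with h | h
  · have := key (-α) (by rwa [negRoots, Set.mem_ofPred_eq, neg_neg])
    rw [neg_neg] at this
    rw [← neg_sub]
    exact this.neg
  · exact key α h

/-- The element `tⁿ ⊗ x` of the affine Lie algebra. -/
def vec (n : ℤ) (x : Sl2) : Hat := ⟨tens (LaurentPolynomial.T n) x, 0, 0⟩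

lemma vec_add (n : ℤ) (x y : Sl2) : vec n (x + y) = vec n x + vec n y :=
  Hat.ext (TensorProduct.tmul_add _ x y) (add_zero _).symm (add_zero _).symm

lemma vec_smul (n : ℤ) (r : ℂ) (x : Sl2) : vec n (r • x) = r • vec n x :=
  Hat.ext (tens_smul_right r _ x) (mul_zero _).symm (mul_zero _).symm

@[elab_as_elim]
lemma hat_induction {p : Hat → Prop} (z : Hat) (add : ∀ x y, p x → p y → p (x + y))
    (smul : ∀ (r : ℂ) x, p x → p (r • x)) (e : ∀ n, p (vec n eElt)) (f : ∀ n, p (vec n fElt))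
    (h : ∀ n, p (vec n hElt)) (c : p ⟨0, 1, 0⟩) (d : p ⟨0, 0, 1⟩) : p z := by
  have hloop : ∀ y : Loop, p ⟨y, 0, 0⟩ := by
    intro y
    induction y using loop_induction_T with
    | zero =>
      rw [show (⟨0, 0, 0⟩ : Hat) = (0 : ℂ) • ⟨0, 0, 1⟩ by ext <;> simp]
      exact smul 0 _ d
    | add x y hx hy =>
      rw [show (⟨x + y, 0, 0⟩ : Hat) = ⟨x, 0, 0⟩ + ⟨y, 0, 0⟩ by ext <;> simp]
      exact add _ _ hx hy
    | tens n x =>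
      change p (vec n x)
      rw [sl2_eq_smul_add x, vec_add, vec_add, vec_smul, vec_smul, vec_smul]
      exact add _ _ (add _ _ (smul _ _ (e n)) (smul _ _ (f n))) (smul _ _ (h n))
  have hz : z = ⟨z.loop, 0, 0⟩ + z.cen • ⟨0, 1, 0⟩ + z.der • ⟨0, 0, 1⟩ := by
    ext <;> simp
  rw [hz]
  exact add _ _ (add _ _ (hloop _) (smul _ _ c)) (smul _ _ d)

lemma thetaHat_vec (n : ℤ) (x : Sl2) : thetaHat (vec n x) = vec (-n) (theta x) :=
  Hat.ext (by
    change loopMap invertT theta (tens (LaurentPolynomial.T n) x) = _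
    rw [loopMap_tens, invertT_T]
    rfl) neg_zero neg_zero

lemma theta_eElt : theta eElt = (-1 : ℂ) • fElt :=
  Subtype.ext (by
    change -(Matrix.single 0 1 1 : Matrix (Fin 2) (Fin 2) ℂ).transpose =
      (-1 : ℂ) • Matrix.single 1 0 1
    rw [Matrix.transpose_single, neg_one_smul])

lemma theta_fElt : theta fElt = (-1 : ℂ) • eElt :=
  Subtype.ext (by
    change -(Matrix.single 1 0 1 : Matrix (Fin 2) (Fin 2) ℂ).transpose =
      (-1 : ℂ) • Matrix.single 0 1 1
    rw [Matrix.transpose_single, neg_one_smul])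

lemma theta_hElt : theta hElt = (-1 : ℂ) • hElt :=
  Subtype.ext (by
    change -(Matrix.single 0 0 1 - Matrix.single 1 1 1 : Matrix (Fin 2) (Fin 2) ℂ).transpose =
      (-1 : ℂ) • (Matrix.single 0 0 1 - Matrix.single 1 1 1)
    rw [Matrix.transpose_sub, Matrix.transpose_single, Matrix.transpose_single, neg_one_smul])

/-- The span over the coefficient ring of the functions `φ (ι x)`, where `x` runs through a set. -/
def spanImage (φ : UHat →+* Family) (s : Set Hat) : Submodule CoeffRing Family :=
  Submodule.span CoeffRing ((fun x => φ (ι ℂ x)) '' s)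

lemma mem_spanImage (φ : UHat →+* Family) {s : Set Hat} {x : Hat} (hx : x ∈ s) :
    φ (ι ℂ x) ∈ spanImage φ s :=
  Submodule.subset_span ⟨x, hx, rfl⟩

lemma const_smul (r : ℂ) (X : UHat) : const (r • X) = algebraMap ℂ CoeffRing r • const X :=
  funext fun a => by
    rw [Family.smul_apply, AlgHom.commutes, Family.const_apply, Family.const_apply]
    rfl

lemma conj_smul (r : ℂ) (X : UHat) : conj (r • X) = algebraMap ℂ CoeffRing r • conj X :=
  funext fun a => by
    rw [Family.smul_apply, AlgHom.commutes, Family.conj_apply, Family.conj_apply, map_smul]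
    rfl

/-- For a root vector `z` of root `α` and `w = z + θ(z)`, one has
`(e^{-α} - e^α) z = wᵃ - e^α w`. -/
lemma const_ι_mem_of_root {α : RootLattice} (hα : α ∈ roots) {z z' : Hat}
    (hz : thetaHat z = z') (hz' : thetaHat z' = z)
    (hAd : ∀ a, Ad a z = (rootValue a α : ℂ) • z)
    (hAd' : ∀ a, Ad a z' = (rootValue a (-α) : ℂ) • z') :
    const (ι ℂ z) ∈ spanImage conj fixedSubalgebra ⊔ spanImage const cartan ⊔
      spanImage const fixedSubalgebra := by
  have hw : z + z' ∈ (fixedSubalgebra : Set Hat) := by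
    change thetaHat (z + z') = z + z'
    rw [map_add, hz, hz', add_comm]
  have key : (expR (-α) - expR α) • const (ι ℂ z) =
      conj (ι ℂ (z + z')) - expR α • const (ι ℂ (z + z')) := by
    funext a
    rw [Family.sub_apply, Family.smul_apply, Family.smul_apply, map_sub, evalR_expR, evalR_expR,
      Family.const_apply, Family.const_apply, Family.conj_apply, conjBy_ι, map_add, hAd, hAd',
      rootValue_inv, rootValue_inv, rootValue_neg, inv_inv, map_add, map_add, map_smul, map_smul]
    module
  rw [← Submodule.smul_mem_iff_of_isUnit _ (isUnit_expR_neg_sub hα), key]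
  exact sub_mem (Submodule.mem_sup_left (Submodule.mem_sup_left (mem_spanImage _ hw)))
    (Submodule.smul_mem _ _ (Submodule.mem_sup_right (mem_spanImage _ hw)))

/-- Over the coefficient ring, `𝔤` is the sum of `𝔨ᵃ`, `𝔥` and `𝔨`. -/
theorem spanImage_const_le : spanImage const Set.univ ≤
    spanImage conj fixedSubalgebra ⊔ spanImage const cartan ⊔ spanImage const fixedSubalgebra := by
  refine Submodule.span_le.2 ?_
  rintro _ ⟨z, -, rfl⟩
  change const (ι ℂ z) ∈ _
  have hcart : ∀ x ∈ cartan, const (ι ℂ x) ∈ spanImage conj fixedSubalgebra ⊔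
      spanImage const cartan ⊔ spanImage const fixedSubalgebra := fun x hx =>
    Submodule.mem_sup_left (Submodule.mem_sup_right (mem_spanImage _ hx))
  have h0 : Hat.h0 ∈ cartan := Submodule.subset_span (by simp)
  have h1 : Hat.h1 ∈ cartan := Submodule.subset_span (by simp)
  induction z using hat_induction with
  | add x y hx hy => rw [map_add, map_add]; exact add_mem hx hy
  | smul r x hx =>
    rw [map_smul, const_smul]
    exact Submodule.smul_mem _ _ hx
  | e n =>
    refine const_ι_mem_of_root (zsmul_delta_add_alpha1_mem n) (z' := vec (-n) (theta eElt))
      (thetaHat_vec n _) ?_ (Ad_e · n) fun a => ?_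
    · rw [thetaHat_vec, theta_eElt, map_smul, theta_fElt, neg_neg, smul_smul]
      norm_num
    · rw [theta_eElt, vec_smul, map_smul, neg_add, ← neg_smul, smul_comm]
      exact congrArg _ (Ad_f a (-n))
  | f n =>
    refine const_ι_mem_of_root (zsmul_delta_sub_alpha1_mem n) (z' := vec (-n) (theta fElt))
      (thetaHat_vec n _) ?_ (Ad_f · n) fun a => ?_
    · rw [thetaHat_vec, theta_fElt, map_smul, theta_eElt, neg_neg, smul_smul]
      norm_num
    · rw [theta_fElt, vec_smul, map_smul, neg_add, ← neg_smul, neg_neg, smul_comm]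
      exact congrArg _ (Ad_e a (-n))
  | h n =>
    by_cases hn : n = 0
    · subst hn
      have : vec 0 hElt = Hat.h1 := by rw [vec, LaurentPolynomial.T_zero, Hat.h1]
      rw [this]
      exact hcart _ h1
    · refine const_ι_mem_of_root (zsmul_delta_mem hn) (z' := vec (-n) (theta hElt))
        (thetaHat_vec n _) ?_ (Ad_h · n) fun a => ?_
      · rw [thetaHat_vec, theta_hElt, map_smul, theta_hElt, neg_neg, smul_smul]
        norm_num
      · rw [theta_hElt, vec_smul, map_smul, ← neg_smul, smul_comm]
        exact congrArg _ (Ad_h a (-n))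
  | c =>
    have : (⟨0, 1, 0⟩ : Hat) = Hat.h0 + Hat.h1 := by ext <;> simp [Hat.h0, Hat.h1]
    rw [this]
    exact hcart _ (add_mem h0 h1)
  | d => exact hcart Hat.d (Submodule.subset_span (by simp))

lemma spanImage_conj_le (s : Set Hat) : spanImage conj s ≤ spanImage const Set.univ := by
  refine Submodule.span_le.2 ?_
  rintro _ ⟨z, -, rfl⟩
  change conj (ι ℂ z) ∈ _
  have hroot : ∀ (α : RootLattice) (z : Hat), (∀ a, Ad a z = (rootValue a α : ℂ) • z) →
      conj (ι ℂ z) ∈ spanImage const Set.univ := by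
    intro α z hz
    have : conj (ι ℂ z) = expR (-α) • const (ι ℂ z) := funext fun a => by
      rw [Family.conj_apply, conjBy_ι, hz, Family.smul_apply, evalR_expR, map_smul, rootValue_inv,
        rootValue_neg, Family.const_apply]
    rw [this]
    exact Submodule.smul_mem _ _ (mem_spanImage _ (Set.mem_univ z))
  have hfix : ∀ r s : ℂ, ∀ a, Ad a ⟨0, r, s⟩ = (rootValue a 0 : ℂ) • (⟨0, r, s⟩ : Hat) := by
    intro r s a
    rw [rootValue_zero, Units.val_one, one_smul]
    exact Hat.ext (map_zero _) rfl rfl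
  induction z using hat_induction with
  | add x y hx hy => rw [map_add, map_add]; exact add_mem hx hy
  | smul r x hx =>
    rw [map_smul, conj_smul]
    exact Submodule.smul_mem _ _ hx
  | e n => exact hroot _ _ (Ad_e · n)
  | f n => exact hroot _ _ (Ad_f · n)
  | h n => exact hroot _ _ (Ad_h · n)
  | c => exact hroot 0 _ (hfix 1 0)
  | d => exact hroot 0 _ (hfix 0 1)

/-! ### Existence -/

/-- The powers of `1 ⊔ φ(𝔰)` lie in the span of `φ(U(𝔰))`. -/
lemma pow_one_sup_spanImage_le (φ : UHat →+* Family) (s : LieSubalgebra ℂ Hat) (n : ℕ) :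
    (1 ⊔ spanImage φ s) ^ n ≤
      Submodule.span CoeffRing (Set.range fun X : UniversalEnvelopingAlgebra ℂ s =>
        φ (envMap s.incl X)) := by
  set S := Submodule.span CoeffRing (Set.range fun X : UniversalEnvelopingAlgebra ℂ s =>
        φ (envMap s.incl X)) with hS
  have h1 : 1 ≤ S := Submodule.one_le.2 (Submodule.subset_span ⟨1, by simp⟩)
  have hmul : S * S ≤ S := by
    rw [hS, Submodule.span_mul_span]
    refine Submodule.span_mono ?_
    rintro _ ⟨_, ⟨X, rfl⟩, _, ⟨Y, rfl⟩, rfl⟩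
    exact ⟨X * Y, by simp⟩
  have hle : 1 ⊔ spanImage φ s ≤ S := by
    refine sup_le h1 (Submodule.span_mono ?_)
    rintro _ ⟨x, hx, rfl⟩
    exact ⟨ι ℂ (⟨x, hx⟩ : s), by simp only [envMap_ι]; rfl⟩
  induction n with
  | zero => exact pow_zero_le (Submodule.one_le.1 h1)
  | succ n ih =>
    exact pow_succ_le fun u hu v hv => hmul (Submodule.mul_mem_mul (ih hu) (hle hv))

/-- The families `a ↦ Γ_a(P)`. -/
def gammaRange : Submodule CoeffRing Family where
  carrier := {φ | ∃ P, ∀ a : regular, gamma a a.2 P = φ a}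
  zero_mem' := ⟨0, fun a => map_zero _⟩
  add_mem' := by
    rintro φ ψ ⟨P, hP⟩ ⟨P', hP'⟩
    exact ⟨P + P', fun a => by rw [map_add, hP, hP']; rfl⟩
  smul_mem' := by
    rintro f φ ⟨P, hP⟩
    refine ⟨f • P, fun a => ?_⟩
    rw [Family.smul_apply, ← hP]
    clear hP
    induction P using TensorProduct.induction_on with
    | zero => simp
    | add x y hx hy => rw [smul_add, map_add, map_add, smul_add, hx, hy]
    | tmul g Z =>
      rw [TensorProduct.smul_tmul', gamma_tmul, gamma_tmul, smul_eq_mul, map_mul, mul_smul]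

lemma conj_mul_const_mul_const_mem (H : UCartan) (X Y : UFixed) :
    conj (envMap fixedSubalgebra.incl X) * const (envMap cartan.incl H) *
      const (envMap fixedSubalgebra.incl Y) ∈ gammaRange :=
  ⟨1 ⊗ₜ (H ⊗ₜ X ⊗ₜ Y), fun a => by
    rw [gamma_tmul, map_one, one_smul, gammaBase_tmul]; rfl⟩

/-- The span of the products of at most `n` factors, sorted into factors from `𝔨ᵃ`, factors from
`𝔥` and factors from `𝔨`. -/
def sortedProducts (n : ℕ) : Submodule CoeffRing Family :=
  Submodule.span CoeffRing {φ | ∃ i j k, i + j + k = n ∧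
    ∃ α ∈ (1 ⊔ spanImage conj fixedSubalgebra) ^ i, ∃ β ∈ (1 ⊔ spanImage const cartan) ^ j,
    ∃ κ ∈ (1 ⊔ spanImage const fixedSubalgebra) ^ k, φ = α * β * κ}

lemma mem_sortedProducts {n i j k : ℕ} (h : i + j + k = n) {α β κ : Family}
    (hα : α ∈ (1 ⊔ spanImage conj fixedSubalgebra) ^ i)
    (hβ : β ∈ (1 ⊔ spanImage const cartan) ^ j)
    (hκ : κ ∈ (1 ⊔ spanImage const fixedSubalgebra) ^ k) : α * β * κ ∈ sortedProducts n :=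
  Submodule.subset_span ⟨i, j, k, h, α, hα, β, hβ, κ, hκ, rfl⟩

lemma sortedProducts_le_gammaRange (n : ℕ) : sortedProducts n ≤ gammaRange := by
  refine Submodule.span_le.2 ?_
  rintro _ ⟨i, j, k, -, α, hα, β, hβ, κ, hκ, rfl⟩
  have h := Submodule.mul_mem_mul (Submodule.mul_mem_mul
    (pow_one_sup_spanImage_le conj fixedSubalgebra i hα)
    (pow_one_sup_spanImage_le const cartan j hβ))
    (pow_one_sup_spanImage_le const fixedSubalgebra k hκ)
  rw [Submodule.span_mul_span, Submodule.span_mul_span] at h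
  refine Submodule.span_le.2 ?_ h
  rintro _ ⟨_, ⟨_, ⟨X, rfl⟩, _, ⟨H, rfl⟩, rfl⟩, _, ⟨Y, rfl⟩, rfl⟩
  exact conj_mul_const_mul_const_mem H X Y

lemma sortedProducts_mono_succ (n : ℕ) : sortedProducts n ≤ sortedProducts (n + 1) := by
  refine Submodule.span_le.2 ?_
  rintro _ ⟨i, j, k, rfl, α, hα, β, hβ, κ, hκ, rfl⟩
  exact mem_sortedProducts (k := k + 1) (by omega) hα hβ (pow_one_sup_mono _ k.le_succ hκ)

lemma commutator_mem_spanImage : ∀ z ∈ spanImage const Set.univ,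
    ∀ w ∈ spanImage const Set.univ, z * w - w * z ∈ spanImage const Set.univ := by
  intro z hz w hw
  induction hz, hw using Submodule.span_induction₂ with
  | mem_mem _ _ hx hy =>
    obtain ⟨x, -, rfl⟩ := hx
    obtain ⟨y, -, rfl⟩ := hy
    have h : ι ℂ x * ι ℂ y - ι ℂ y * ι ℂ x = ι ℂ ⁅x, y⁆ := (ι_lie x y).symm
    change const (ι ℂ x) * const (ι ℂ y) - const (ι ℂ y) * const (ι ℂ x) ∈ _
    rw [← map_mul const, ← map_mul const, ← map_sub const, h]
    exact mem_spanImage _ (Set.mem_univ _)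
  | zero_left y hy => simp
  | zero_right x hx => simp
  | add_left x y z hx hy hz h1 h2 =>
    convert add_mem h1 h2 using 1
    noncomm_ring
  | add_right x y z hx hy hz h1 h2 =>
    convert add_mem h1 h2 using 1
    noncomm_ring
  | smul_left r x y hx hy h =>
    rw [smul_mul_assoc, mul_smul_comm, ← smul_sub]
    exact Submodule.smul_mem _ _ h
  | smul_right r x y hx hy h =>
    rw [smul_mul_assoc, mul_smul_comm, ← smul_sub]
    exact Submodule.smul_mem _ _ h

/-- Every product of elements of `𝔤` can be sorted: moving a factor past another one creates a
commutator, that is, a product with fewer factors. -/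
lemma pow_one_sup_le_sortedProducts (n : ℕ) :
    (1 ⊔ spanImage const Set.univ) ^ n ≤ sortedProducts n := by
  induction n with
  | zero =>
    refine pow_zero_le ?_
    have := mem_sortedProducts (n := 0) (i := 0) (j := 0) (k := 0) rfl (α := 1) (β := 1) (κ := 1)
      (one_mem_pow_zero _) (one_mem_pow_zero _) (one_mem_pow_zero _)
    rwa [mul_one, mul_one] at this
  | succ n ih =>
    have hA : ∀ i, (1 ⊔ spanImage conj fixedSubalgebra) ^ i ≤
        (1 ⊔ spanImage const Set.univ) ^ i := fun i =>
      pow_mono (sup_le_sup_left (spanImage_conj_le _) _) i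
    have hS : ∀ (s : Set Hat), spanImage const s ≤ spanImage const Set.univ := fun s =>
      Submodule.span_mono (Set.image_mono (Set.subset_univ s))
    have hC : ∀ (s : Set Hat) i, (1 ⊔ spanImage const s) ^ i ≤
        (1 ⊔ spanImage const Set.univ) ^ i := fun s i =>
      pow_mono (sup_le_sup_left (hS s) _) i
    refine pow_succ_le' fun u hu v hv => ?_
    replace hv := ih hv
    obtain ⟨r, z, hz, rfl⟩ := mem_one_sup_iff.1 hu
    obtain ⟨z', hz', y, hy, rfl⟩ := Submodule.mem_sup.1 (spanImage_const_le hz)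
    obtain ⟨x, hx, h, hh, rfl⟩ := Submodule.mem_sup.1 hz'
    rw [sortedProducts] at hv
    induction hv using Submodule.span_induction with
    | zero => simp
    | add v w _ _ hv hw => rw [mul_add]; exact add_mem hv hw
    | smul f v _ hv => rw [mul_smul_comm]; exact Submodule.smul_mem _ _ hv
    | mem v hv =>
      obtain ⟨i, j, k, rfl, α, hα, β, hβ, κ, hκ, rfl⟩ := hv
      have e : (algebraMap CoeffRing Family r + (x + h + y)) * (α * β * κ) =
          r • (α * β * κ) + x * α * β * κ + (α * (h * β) * κ + (h * α - α * h) * β * κ) +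
            (α * β * (κ * y) + (y * (α * β * κ) - α * β * κ * y)) := by
        rw [Algebra.smul_def]
        noncomm_ring
      have hh' := hS _ hh
      have hy' := hS _ hy
      have hlow : ∀ {w : Family}, w ∈ (1 ⊔ spanImage const Set.univ) ^ (i + j + k) →
          w ∈ sortedProducts (i + j + k + 1) := fun hw => sortedProducts_mono_succ _ (ih hw)
      rw [e]
      refine add_mem (add_mem (add_mem ?_ ?_) (add_mem ?_ ?_)) (add_mem ?_ ?_)
      · exact Submodule.smul_mem _ _ (sortedProducts_mono_succ _ (mem_sortedProducts rfl hα hβ hκ))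
      · refine mem_sortedProducts (i := 1 + i) (by omega)
          (mul_mem_pow_add (mem_pow_one ?_) hα) hβ hκ
        exact mem_one_sup_of_mem hx
      · refine mem_sortedProducts (j := 1 + j) (by omega) hα
          (mul_mem_pow_add (mem_pow_one ?_) hβ) hκ
        exact mem_one_sup_of_mem hh
      · exact hlow (mul_mem_pow_add (mul_mem_pow_add
          (commutator_mem_pow commutator_mem_spanImage hh' (hA i hα)) (hC _ j hβ)) (hC _ k hκ))
      · exact mem_sortedProducts (k := k + 1) (by omega) hα hβ
          (mul_mem_pow_succ hκ (mem_one_sup_of_mem hy))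
      · exact hlow (commutator_mem_pow commutator_mem_spanImage hy'
          (mul_mem_pow_add (mul_mem_pow_add (hA i hα) (hC _ j hβ)) (hC _ k hκ)))

theorem exists_gamma_eq (X : UHat) : ∃ P : CoeffRing ⊗[ℂ] (UCartan ⊗[ℂ] UFixed ⊗[ℂ] UFixed),
    ∀ a (ha : a ∈ regular), gamma a ha P = X := by
  have h : ∃ n, const X ∈ (1 ⊔ spanImage const Set.univ) ^ n := by
    induction X using enveloping_induction with
    | one => exact ⟨0, by rw [map_one]; exact one_mem_pow_zero _⟩
    | smul r X hX =>
      obtain ⟨n, hn⟩ := hX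
      exact ⟨n, by rw [const_smul]; exact Submodule.smul_mem _ _ hn⟩
    | ι_mul x X hX =>
      obtain ⟨n, hn⟩ := hX
      refine ⟨1 + n, ?_⟩
      rw [map_mul]
      exact mul_mem_pow_add
        (mem_pow_one (mem_one_sup_of_mem (mem_spanImage _ (Set.mem_univ x)))) hn
    | add X Y hX hY =>
      obtain ⟨m, hm⟩ := hX
      obtain ⟨n, hn⟩ := hY
      refine ⟨max m n, ?_⟩
      rw [map_add]
      exact add_mem (pow_one_sup_mono _ (le_max_left m n) hm)
        (pow_one_sup_mono _ (le_max_right m n) hn)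
  obtain ⟨n, hn⟩ := h
  obtain ⟨P, hP⟩ := sortedProducts_le_gammaRange n (pow_one_sup_le_sortedProducts n hn)
  exact ⟨P, fun a ha => hP ⟨a, ha⟩⟩

end AffineSl2

end

theorem theorem4p2 (X : AffineSl2.UHat) :
    ∃! P : AffineSl2.CoeffRing ⊗[ℂ]
        (AffineSl2.UCartan ⊗[ℂ] AffineSl2.UFixed ⊗[ℂ] AffineSl2.UFixed),
      ∀ (a : AffineSl2.Torus) (ha : a ∈ AffineSl2.regular), AffineSl2.gamma a ha P = X := by
  obtain ⟨P, hP⟩ := AffineSl2.exists_gamma_eq X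
  exact ⟨P, hP, fun P' hP' =>
    AffineSl2.eq_of_gamma_eq fun a ha => (hP' a ha).trans (hP a ha).symm⟩
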